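/- **Theorem 3.1.** *Setting.* Let $T>0$ and $n,m\ge 0$. Let $A,C,D,Q_I,Q,\bar Q_I,\bar Q,\Gamma,\bar\Gamma\in\mathbb R^{n\times n}$, $B,F\in\mathbb R^{n\times m}$, $R\in\mathbb R^{m\times m}$ positive definite, and $\mathsf s,\bar{\mathsf s},\eta,\bar\eta,z^0\in\mathbb R^n$. Fix errors $\bar E,E_i\in\mathbb R^n$ and put $E=(\bar E^T,E_i^T)^T$. Suppose that the following functions on $[0,T]$ are given. - $P_1$ and $P_0$ solve $$-\dot P_1=P_1A+A^TP_1+(Q_I+Q)-P_1BR^{-1}B^TP_1,\qquad P_1(T)=\bar Q_I+\bar Q,$$ $$-\dot P_0=P_0(A+C)+A^TP_0+(Q_I+Q-Q\Gamma)-P_0(B+F)R^{-1}B^TP_0,\qquad P_0(T)=\bar Q_I+\bar Q-\bar Q\bar\Gamma.$$ - $\mathcal G$, $z_i$ and $g_i$ solve $$\dot{\mathcal G}=-(A^T-P_0(B+F)R^{-1}B^T)\mathcal G+Q_I\mathsf s+Q\eta,\qquad \mathcal G(T)=-\bar Q_I\bar{\mathsf s}-\bar Q\bar\eta,$$ $$\dot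 z_i=(A+C-(B+F)R^{-1}B^TP_0)z_i-(B+F)R^{-1}B^T\mathcal G,\qquad z_i(0)=z^0+E_i,$$ $$\dot g_i=-[(A^T-P_1BR^{-1}B^T)g_i+(P_1C-Q\Gamma)z_i+P_1F\bar u_i-Q_I\mathsf s-Q\eta],\qquad g_i(T)=-\bar Q_I\bar{\mathsf s}-\bar Q(\bar\Gamma z_i(T)+\bar\eta),$$ where $\bar u_i=-R^{-1}B^T(P_0z_i+\mathcal G)$. - $\Phi_1,\Phi_g,\Phi_z,\Phi_x$ solve $$\dot\Phi_1=(A+C-(B+F)R^{-1}B^TP_0)\Phi_1,\qquad \Phi_1(0)=I,$$ $$\dot\Phi_g=-(A^T-P_1(B+F)R^{-1}B^T)\Phi_g,\qquad \Phi_g(T)=I,$$ $$\dot\Phi_z=(A+C-(B+F)R^{-1}B^TP_1)\Phi_z,\qquad \Phi_z(0)=I,$$ $$\dot\Phi_x=(A-BR^{-1}B^TP_1)\Phi_x,\qquad \Phi_x(0)=I.$$ Define $$\mathcal M_g(t)=-\Phi_g(t)\Big[\Phi_g^{-1}(T)\bar Q\bar\Gamma\Phi_1(T)\Phi_1^{-1}(0)+\int_T^t\Phi_g^{-1}(P_1C-P_1FR^{-1}B^TP_1-Q\Gamma)\Phi_1\Phi_1^{-1}(0)\,d\omega\Big],$$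 $$\mathcal M_z(t)=-\Phi_z(t)\int_0^t\Phi_z^{-1}(B+F)R^{-1}B^T\mathcal M_g\,d\omega,$$ $$\bar{\mathcal K}=(C-FR^{-1}B^TP_1)\mathcal M_z-FR^{-1}B^T\mathcal M_g,\qquad \mathcal K_i=FR^{-1}B^T\mathcal M_g-(C-FR^{-1}B^TP_1)\Phi_1\Phi_1^{-1}(0),$$ $$\mathcal K=(\bar{\mathcal K},\mathcal K_i),\qquad \mathcal B_i=(C-FR^{-1}B^TP_1)z_i-(B+F)R^{-1}B^Tg_i .$$ Let $W_i$ be an $n$-dimensional standard Wiener process with respect to a filtration $(\mathcal F_t)$ on a probability space. Let the private trajectory $x_i$ be an adapted, almost surely continuous solution on $[0,T]$ of $$dx_i=[(A-BR^{-1}B^TP_1)x_i+\mathcal B_i+\mathcal KE]\,dt+D\,dW_i .$$ *Claim.* Let $0\le s<t\le T$ and $x\in\mathbb R^n$, and put $$F(t|s,x)=\Phi_x(t)\Phi_x^{-1}(s)x+\Phi_x(t)\int_s^t\Phi_x^{-1}\mathcal B_i\,d\omega,$$ $$\mu(t|s,x;E)=F(t|s,x)+\Phi_x(t)\int_s^t\Phi_x^{-1}\mathcal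 K\,d\omega\,E,$$ $$\Sigma(t|s)=\Phi_x(t)\int_s^t\Phi_x^{-1}DD^T\Phi_x^{-T}\,d\omega\;\Phi_x^T(t).$$ Then $\Sigma=\Sigma(t|s)$ is positive semidefinite, and the transition law of the private trajectory from $(s,x)$ to time $t$ is the normal law $\mathcal N_n(\mu(t|s,x;E),\Sigma)$. That is, every solution of the equation on $[s,T]$ with value $x$ at time $s$ has this law at time $t$, and the conditional law of $x_i(t)$ given $\mathcal F_s$ is almost surely $\mathcal N_n(\mu(t|s,x_i(s);E),\Sigma)$. If $\Sigma$ is nonsingular, which is the case whenever $D$ is nonsingular, then in the same two senses the transition law has the density (with $\mu=\mu(t|s,x;E)$) $$\mathcal T(t,y|s,x;E)=\frac1{\sqrt{(2\pi)^n|\Sigma|}}\exp\Big(-\tfrac12(y-\mu)^T\Sigma^{-1}(y-\mu)\Big).$$ -/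

import Mathlib

open MeasureTheory ProbabilityTheory
open scoped NNReal ENNReal Matrix

noncomputable section

namespace ErroneousMFG

/-! ### Entrywise calculus of matrix- and vector-valued functions -/

/-- `M` solves `M'(t) = V(t)` on `[0,T]` (one-sided derivatives at the end points). -/
def MatrixODE {k l : ℕ} (T : ℝ) (M V : ℝ → Matrix (Fin k) (Fin l) ℝ) : Prop :=
  ∀ t ∈ Set.Icc 0 T, ∀ i j, HasDerivWithinAt (fun u => M u i j) (V t i j) (Set.Icc 0 T) t

/-- `v` solves `v'(t) = w(t)` on `[0,T]` (one-sided derivatives at the end points). -/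
def VectorODE {k : ℕ} (T : ℝ) (v w : ℝ → Fin k → ℝ) : Prop :=
  ∀ t ∈ Set.Icc 0 T, ∀ i, HasDerivWithinAt (fun u => v u i) (w t i) (Set.Icc 0 T) t

/-- The entrywise integral `∫_a^b M(ω) dω` of a matrix-valued function. -/
def matrixIntegral {ι κ : Type} (a b : ℝ) (M : ℝ → Matrix ι κ ℝ) : Matrix ι κ ℝ :=
  Matrix.of fun i j => ∫ u in a..b, M u i j

/-- The coordinatewise integral `∫_a^b v(ω) dω` of a vector-valued function. -/
def vectorIntegral {ι : Type} (a b : ℝ) (v : ℝ → ι → ℝ) : ι → ℝ :=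
  fun i => ∫ u in a..b, v u i

/-! ### The game -/

/-- The parameters of the linear-quadratic mean field game with `n`-dimensional states and
`m`-dimensional controls: the dynamics are
`dxᵢ = (A xᵢ + B uᵢ + C z + F ū) dt + D dWᵢ`; the weights, targets `s`, `sbar`, and the
coefficients `Γ`, `η`, `Γbar`, `ηbar` belong to the running and terminal costs. -/
structure Parameters (n m : ℕ) where
  A : Matrix (Fin n) (Fin n) ℝ
  B : Matrix (Fin n) (Fin m) ℝ
  C : Matrix (Fin n) (Fin n) ℝ
  F : Matrix (Fin n) (Fin m) ℝ
  D : Matrix (Fin n) (Fin n) ℝ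
  QI : Matrix (Fin n) (Fin n) ℝ
  Q : Matrix (Fin n) (Fin n) ℝ
  R : Matrix (Fin m) (Fin m) ℝ
  QIbar : Matrix (Fin n) (Fin n) ℝ
  Qbar : Matrix (Fin n) (Fin n) ℝ
  Γ : Matrix (Fin n) (Fin n) ℝ
  Γbar : Matrix (Fin n) (Fin n) ℝ
  s : Fin n → ℝ
  sbar : Fin n → ℝ
  η : Fin n → ℝ
  ηbar : Fin n → ℝ

/-- The deterministic functions of time that the agent computes: the Riccati solutions `P0`, `P1`,
the offset `G` of the equilibrium costate, the predicted mean field state `z` and the feedback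
offset `g` of the agent, and the fundamental matrices `Φ1`, `Φg`, `Φz`, `Φx`. -/
structure Profile (n : ℕ) where
  P0 : ℝ → Matrix (Fin n) (Fin n) ℝ
  P1 : ℝ → Matrix (Fin n) (Fin n) ℝ
  G : ℝ → Fin n → ℝ
  z : ℝ → Fin n → ℝ
  g : ℝ → Fin n → ℝ
  Φ1 : ℝ → Matrix (Fin n) (Fin n) ℝ
  Φg : ℝ → Matrix (Fin n) (Fin n) ℝ
  Φz : ℝ → Matrix (Fin n) (Fin n) ℝ
  Φx : ℝ → Matrix (Fin n) (Fin n) ℝ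

variable {n m : ℕ}

/-- The matrix `R⁻¹ Bᵀ`. -/
def Parameters.gain (Θ : Parameters n m) : Matrix (Fin m) (Fin n) ℝ := Θ.R⁻¹ * Θ.Bᵀ

/-- The mean field control `ū(t) = - R⁻¹ Bᵀ (P0(t) z(t) + G(t))` predicted by the agent. -/
def Profile.ubar (p : Profile n) (Θ : Parameters n m) (t : ℝ) : Fin m → ℝ :=
  -(Θ.gain *ᵥ (p.P0 t *ᵥ p.z t + p.G t))

/-- The closed-loop matrix `A - B R⁻¹ Bᵀ P1(t)` of a single agent. -/
def Profile.closedLoop (p : Profile n) (Θ : Parameters n m) (t : ℝ) :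
    Matrix (Fin n) (Fin n) ℝ :=
  Θ.A - Θ.B * Θ.gain * p.P1 t

/-- The functions in `p` solve their defining equations on `[0,T]`, where `zi0` is the initial mean
field state as observed by the agent. -/
structure Profile.Solves (p : Profile n) (Θ : Parameters n m) (T : ℝ) (zi0 : Fin n → ℝ) :
    Prop where
  P1_ode : MatrixODE T p.P1 fun t =>
    -(p.P1 t * Θ.A + Θ.Aᵀ * p.P1 t + (Θ.QI + Θ.Q) - p.P1 t * Θ.B * Θ.gain * p.P1 t)
  P1_final : p.P1 T = Θ.QIbar + Θ.Qbar
  P0_ode : MatrixODE T p.P0 fun t =>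
    -(p.P0 t * (Θ.A + Θ.C) + Θ.Aᵀ * p.P0 t + (Θ.QI + Θ.Q - Θ.Q * Θ.Γ)
      - p.P0 t * (Θ.B + Θ.F) * Θ.gain * p.P0 t)
  P0_final : p.P0 T = Θ.QIbar + Θ.Qbar - Θ.Qbar * Θ.Γbar
  G_ode : VectorODE T p.G fun t =>
    -((Θ.Aᵀ - p.P0 t * (Θ.B + Θ.F) * Θ.gain) *ᵥ p.G t) + Θ.QI *ᵥ Θ.s + Θ.Q *ᵥ Θ.η
  G_final : p.G T = -(Θ.QIbar *ᵥ Θ.sbar) - Θ.Qbar *ᵥ Θ.ηbar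
  z_ode : VectorODE T p.z fun t =>
    (Θ.A + Θ.C - (Θ.B + Θ.F) * Θ.gain * p.P0 t) *ᵥ p.z t - ((Θ.B + Θ.F) * Θ.gain) *ᵥ p.G t
  z_init : p.z 0 = zi0
  g_ode : VectorODE T p.g fun t =>
    -((Θ.Aᵀ - p.P1 t * Θ.B * Θ.gain) *ᵥ p.g t + (p.P1 t * Θ.C - Θ.Q * Θ.Γ) *ᵥ p.z t
      + (p.P1 t * Θ.F) *ᵥ p.ubar Θ t - Θ.QI *ᵥ Θ.s - Θ.Q *ᵥ Θ.η)
  g_final : p.g T = -(Θ.QIbar *ᵥ Θ.sbar) - Θ.Qbar *ᵥ (Θ.Γbar *ᵥ p.z T + Θ.ηbar)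
  Φ1_ode : MatrixODE T p.Φ1 fun t => (Θ.A + Θ.C - (Θ.B + Θ.F) * Θ.gain * p.P0 t) * p.Φ1 t
  Φ1_init : p.Φ1 0 = 1
  Φg_ode : MatrixODE T p.Φg fun t => -((Θ.Aᵀ - p.P1 t * (Θ.B + Θ.F) * Θ.gain) * p.Φg t)
  Φg_final : p.Φg T = 1
  Φz_ode : MatrixODE T p.Φz fun t => (Θ.A + Θ.C - (Θ.B + Θ.F) * Θ.gain * p.P1 t) * p.Φz t
  Φz_init : p.Φz 0 = 1
  Φx_ode : MatrixODE T p.Φx fun t => p.closedLoop Θ t * p.Φx t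
  Φx_init : p.Φx 0 = 1

/-- The matrix `M_g(t)`, the sensitivity of the feedback offset to the initial error. -/
def Profile.Mg (p : Profile n) (Θ : Parameters n m) (T t : ℝ) : Matrix (Fin n) (Fin n) ℝ :=
  -(p.Φg t * ((p.Φg T)⁻¹ * Θ.Qbar * Θ.Γbar * p.Φ1 T * (p.Φ1 0)⁻¹
    + matrixIntegral T t fun u =>
        (p.Φg u)⁻¹ * (p.P1 u * Θ.C - p.P1 u * Θ.F * Θ.gain * p.P1 u - Θ.Q * Θ.Γ)
          * p.Φ1 u * (p.Φ1 0)⁻¹))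

/-- The matrix `M_z(t)`, the sensitivity of the actual mean field state to the mean error. -/
def Profile.Mz (p : Profile n) (Θ : Parameters n m) (T t : ℝ) : Matrix (Fin n) (Fin n) ℝ :=
  -(p.Φz t * matrixIntegral 0 t fun u =>
      (p.Φz u)⁻¹ * (Θ.B + Θ.F) * Θ.gain * p.Mg Θ T u)

/-- The coefficient `K̄(t)` of the mean error `Ē` in the drift. -/
def Profile.Kbar (p : Profile n) (Θ : Parameters n m) (T t : ℝ) : Matrix (Fin n) (Fin n) ℝ :=
  (Θ.C - Θ.F * Θ.gain * p.P1 t) * p.Mz Θ T t - Θ.F * Θ.gain * p.Mg Θ T t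

/-- The coefficient `Kᵢ(t)` of the private error `Eᵢ` in the drift. -/
def Profile.Ki (p : Profile n) (Θ : Parameters n m) (T t : ℝ) : Matrix (Fin n) (Fin n) ℝ :=
  Θ.F * Θ.gain * p.Mg Θ T t - (Θ.C - Θ.F * Θ.gain * p.P1 t) * p.Φ1 t * (p.Φ1 0)⁻¹

/-- The block row `K(t) = (K̄(t), Kᵢ(t))`. -/
def Profile.K (p : Profile n) (Θ : Parameters n m) (T t : ℝ) :
    Matrix (Fin n) (Fin n ⊕ Fin n) ℝ :=
  Matrix.fromCols (p.Kbar Θ T t) (p.Ki Θ T t)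

/-- The stacked error `E = (Ē, Eᵢ)`. -/
def stackedError (Ebar Ei : Fin n → ℝ) : Fin n ⊕ Fin n → ℝ := Sum.elim Ebar Ei

/-- The known inhomogeneity `(C - F R⁻¹ Bᵀ P1(t)) z(t) - (B + F) R⁻¹ Bᵀ g(t)`. -/
def Profile.inhomogeneity (p : Profile n) (Θ : Parameters n m) (t : ℝ) : Fin n → ℝ :=
  (Θ.C - Θ.F * Θ.gain * p.P1 t) *ᵥ p.z t - ((Θ.B + Θ.F) * Θ.gain) *ᵥ p.g t

/-- The drift of the agent's private trajectory. -/
def Profile.drift (p : Profile n) (Θ : Parameters n m) (T : ℝ) (Ebar Ei : Fin n → ℝ)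
    (t : ℝ) (x : Fin n → ℝ) : Fin n → ℝ :=
  ((Θ.A - Θ.B * Θ.gain * p.P1 t) *ᵥ x - ((Θ.B + Θ.F) * Θ.gain) *ᵥ p.g t
    + (Θ.C - Θ.F * Θ.gain * p.P1 t) *ᵥ p.z t)
    + (p.Kbar Θ T t *ᵥ Ebar + p.Ki Θ T t *ᵥ Ei)

/-! ### Wiener processes and the private trajectory -/

/-- `W` is an `n`-dimensional standard Wiener process with respect to the filtration `𝓕`: it is
adapted, its coordinates are independent real Brownian motions, and its increments after time `s`
are independent of `𝓕 s`. -/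
structure IsWienerProcess {Ω : Type*} {mΩ : MeasurableSpace Ω} (P : Measure Ω)
    (𝓕 : Filtration ℝ≥0 mΩ) (W : ℝ≥0 → Ω → EuclideanSpace ℝ (Fin n)) : Prop where
  adapted : ∀ t, Measurable[𝓕 t] (W t)
  brownian : ∀ i, IsBrownianReal (fun t ω => W t ω i) P
  indep_coords : iIndepFun (fun i ω (t : ℝ≥0) => W t ω i) P
  indep_increments : ∀ s t, s ≤ t →
    Indep (MeasurableSpace.comap (fun ω => W t ω - W s ω) inferInstance) (𝓕 s) P

/-- `X` is a solution on `[r,T]` of the SDE of the private trajectory,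
`dX = drift(t, X) dt + D dW`: it is adapted, almost surely continuous, and almost surely satisfies
`X(t) = X(r) + ∫_r^t drift(u, X(u)) du + D (W(t) - W(r))` for all `t ∈ [r,T]`. As `D` is constant,
the stochastic integral `∫_r^t D dW` is `D (W(t) - W(r))`. The initial value `X(r)` is any
`𝓕 r`-measurable random vector, deterministic ones included. -/
structure IsPrivateTrajectory {Ω : Type*} {mΩ : MeasurableSpace Ω} (P : Measure Ω)
    (𝓕 : Filtration ℝ≥0 mΩ) (W : ℝ≥0 → Ω → EuclideanSpace ℝ (Fin n))
    (Θ : Parameters n m) (T : ℝ≥0) (p : Profile n) (Ebar Ei : Fin n → ℝ)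
    (r : ℝ≥0) (X : ℝ≥0 → Ω → EuclideanSpace ℝ (Fin n)) : Prop where
  adapted : ∀ t ∈ Set.Icc r T, Measurable[𝓕 t] (X t)
  continuous : ∀ᵐ ω ∂P, ContinuousOn (fun t => X t ω) (Set.Icc r T)
  sde : ∀ᵐ ω ∂P, ∀ t ∈ Set.Icc r T,
    (X t ω).ofLp = (X r ω).ofLp
      + vectorIntegral r t (fun u => p.drift Θ T Ebar Ei u (X u.toNNReal ω).ofLp)
      + Θ.D *ᵥ (W t ω - W r ω).ofLp

/-! ### The transition density -/

/-- `F(t|s,x) = Φx(t) Φx(s)⁻¹ x + Φx(t) ∫_s^t Φx(ω)⁻¹ Bᵢ(ω) dω`. -/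
def Profile.freeMean (p : Profile n) (Θ : Parameters n m) (s t : ℝ) (x : Fin n → ℝ) :
    Fin n → ℝ :=
  (p.Φx t * (p.Φx s)⁻¹) *ᵥ x
    + p.Φx t *ᵥ vectorIntegral s t fun u => (p.Φx u)⁻¹ *ᵥ p.inhomogeneity Θ u

/-- The mean `μ(t|s,x;E) = F(t|s,x) + Φx(t) (∫_s^t Φx(ω)⁻¹ K(ω) dω) E`. -/
def Profile.mean (p : Profile n) (Θ : Parameters n m) (T : ℝ) (Ebar Ei : Fin n → ℝ)
    (s t : ℝ) (x : EuclideanSpace ℝ (Fin n)) : EuclideanSpace ℝ (Fin n) :=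
  WithLp.toLp 2 (p.freeMean Θ s t x.ofLp
    + (p.Φx t * matrixIntegral s t fun u => (p.Φx u)⁻¹ * p.K Θ T u) *ᵥ stackedError Ebar Ei)

/-- The covariance `Σ(t|s) = Φx(t) (∫_s^t Φx(ω)⁻¹ D Dᵀ Φx(ω)⁻ᵀ dω) Φx(t)ᵀ`. -/
def Profile.cov (p : Profile n) (Θ : Parameters n m) (s t : ℝ) : Matrix (Fin n) (Fin n) ℝ :=
  p.Φx t * (matrixIntegral s t fun u => (p.Φx u)⁻¹ * Θ.D * Θ.Dᵀ * ((p.Φx u)⁻¹)ᵀ) * (p.Φx t)ᵀ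

/-- The density
`((2π)ⁿ |S|)^(-1/2) exp (- (y - μ)ᵀ S⁻¹ (y - μ) / 2)`. -/
def gaussianDensity (μ : EuclideanSpace ℝ (Fin n)) (S : Matrix (Fin n) (Fin n) ℝ)
    (y : EuclideanSpace ℝ (Fin n)) : ℝ :=
  1 / Real.sqrt ((2 * Real.pi) ^ n * S.det)
    * Real.exp (-(1 / 2) * ((y - μ).ofLp ⬝ᵥ (S⁻¹ *ᵥ (y - μ).ofLp)))

/-- `T(t,y|s,x;E)`. -/
def Profile.transitionDensity (p : Profile n) (Θ : Parameters n m) (T : ℝ)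
    (Ebar Ei : Fin n → ℝ) (s t : ℝ) (x y : EuclideanSpace ℝ (Fin n)) : ℝ :=
  gaussianDensity (p.mean Θ T Ebar Ei s t x) (p.cov Θ s t) y

/-- `κ x` is the law at time `t` of a solution of the SDE that is at the point `x` at time `s`. -/
def IsLawFromPoints {Ω : Type*} {mΩ : MeasurableSpace Ω} (P : Measure Ω)
    (𝓕 : Filtration ℝ≥0 mΩ) (W : ℝ≥0 → Ω → EuclideanSpace ℝ (Fin n))
    (Θ : Parameters n m) (T : ℝ≥0) (p : Profile n) (Ebar Ei : Fin n → ℝ) (s t : ℝ≥0)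
    (κ : EuclideanSpace ℝ (Fin n) → Measure (EuclideanSpace ℝ (Fin n))) : Prop :=
  ∀ (x : EuclideanSpace ℝ (Fin n)) (X : ℝ≥0 → Ω → EuclideanSpace ℝ (Fin n)),
    IsPrivateTrajectory P 𝓕 W Θ T p Ebar Ei s X → (∀ᵐ ω ∂P, X s ω = x) → P.map (X t) = κ x

/-- `κ` is the transition law from time `s` to time `t` of the process `X`: given the past `𝓕 s`,
the random vector `X t` has conditional law `κ (X s)`. -/
def IsTransitionLaw {Ω : Type*} {mΩ : MeasurableSpace Ω} (P : Measure Ω)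
    (𝓕 : Filtration ℝ≥0 mΩ) (X : ℝ≥0 → Ω → EuclideanSpace ℝ (Fin n)) (s t : ℝ≥0)
    (κ : EuclideanSpace ℝ (Fin n) → Measure (EuclideanSpace ℝ (Fin n))) : Prop :=
  ∀ S : Set (EuclideanSpace ℝ (Fin n)), MeasurableSet S →
    P⟦X t ⁻¹' S | 𝓕 s⟧ =ᵐ[P] fun ω => (κ (X s ω)).real S

end ErroneousMFG

end

open ErroneousMFG

/-! The drift of the private trajectory is affine in the state, `M x + b` with `M = p.closedLoop Θ`,
and the noise coefficient `D` is constant. So the equation is solved path by path, without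
stochastic integration. The equations of the game enter mostly through the continuity of the
coefficients they produce. Invertibility of fundamental matrices is needed as well, since several
coefficients contain inverses.

Fix `ξ` and put `h(v) = ξᵀ Φx(t) Φx(v)⁻¹`, a solution of the adjoint equation `h' = -h M` with `h(t)
= ξ`. With `w = W - W(s)`, the path `x - D w` is differentiable although `x` need not be. The
product rule for `h · (x - D w)` makes the terms in `M x` cancel. What is left says that `ξ · (x(t)
- μ)`, where `μ` is the mean started from `x(s)`, equals the expression obtained from `∫ h D dw` by
integration by parts. Since `h` is continuously differentiable and `w` continuous, this is a
pathwise limit of the sums of `h(vⱼ) D · (w(vⱼ₊₁) - w(vⱼ))`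
(`tendsto_sum_vecMul_dotProduct_increment`, `IsPrivateTrajectory.ae_tendsto_noise`).

On an event `A` of the past, independence of increments computes the characteristic function of such
a sum: `P(A)` times a Gaussian factor whose exponent contains a Riemann sum of `∫ |h D|²`, and this
integral is `ξᵀ Σ ξ`. In the limit (`IsPrivateTrajectory.setIntegral_cexp_noise`) the deviation from
the mean has law `N(0, Σ)` on every such event, after division by `P(A)` when that is positive.
Hence the deviation is independent of the past. Adding back the mean, a function of `x(s)`, gives
both forms of the transition law.

The density is a separate matter: the normal law is the affine image of the standard one under `x ↦
μ + √Σ x`, and a linear change of variables applies when `Σ` is nonsingular. -/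

namespace ErroneousMFG

/-! ### Linear differential equations and fundamental matrices. -/

section MatrixCalculus

attribute [local instance] Matrix.linftyOpNormedAddCommGroup Matrix.linftyOpNormedSpace
  Matrix.linftyOpNormedRing Matrix.linftyOpNormedAlgebra

variable {n k l : ℕ} {T : ℝ}

theorem MatrixODE.continuousOn {M V : ℝ → Matrix (Fin k) (Fin l) ℝ} (h : MatrixODE T M V) :
    ContinuousOn M (Set.Icc 0 T) :=
  continuousOn_pi.2 fun i => continuousOn_pi.2 fun j t ht => (h t ht i j).continuousWithinAt

theorem VectorODE.continuousOn {v w : ℝ → Fin k → ℝ} (h : VectorODE T v w) :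
    ContinuousOn v (Set.Icc 0 T) :=
  continuousOn_pi.2 fun i t ht => (h t ht i).continuousWithinAt

theorem MatrixODE.hasDerivWithinAt {M V : ℝ → Matrix (Fin k) (Fin l) ℝ} (h : MatrixODE T M V)
    {t : ℝ} (ht : t ∈ Set.Icc 0 T) : HasDerivWithinAt M (V t) (Set.Icc 0 T) t := by
  refine hasDerivWithinAt_pi.2 fun i => hasDerivWithinAt_pi.2 fun j => h t ht i j

/-- A solution of a homogeneous linear differential equation that vanishes at one point vanishes
everywhere. -/
theorem eq_zero_of_linear_ode {M : ℝ → Matrix (Fin n) (Fin n) ℝ} {y : ℝ → Fin n → ℝ}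
    (hM : ContinuousOn M (Set.Icc 0 T))
    (hy : ∀ t ∈ Set.Icc 0 T, HasDerivWithinAt y (M t *ᵥ y t) (Set.Icc 0 T) t)
    {u : ℝ} (hu : u ∈ Set.Icc 0 T) (hyu : y u = 0) {t : ℝ} (ht : t ∈ Set.Icc 0 T) : y t = 0 := by
  obtain ⟨c, hc⟩ := isCompact_Icc.exists_bound_of_continuousOn hM
  have hlip : ∀ t ∈ Set.Icc 0 T,
      LipschitzOnWith c.toNNReal (fun x : Fin n → ℝ => M t *ᵥ x) Set.univ := by
    intro t ht
    refine LipschitzOnWith.of_dist_le_mul fun x _ x' _ => ?_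
    rw [dist_eq_norm, dist_eq_norm, ← Matrix.mulVec_sub]
    -- The chosen matrix norm is the operator norm for the sup norm on vectors, so a bound on `‖M
    -- t‖` is a Lipschitz constant.
    refine (Matrix.linfty_opNorm_mulVec _ _).trans ?_
    gcongr
    exact (hc t ht).trans (Real.le_coe_toNNReal c)
  have hcont : ContinuousOn y (Set.Icc 0 T) := fun t ht => (hy t ht).continuousWithinAt
  have hzero : ∀ (t : ℝ) (s : Set ℝ),
      HasDerivWithinAt (fun _ : ℝ => (0 : Fin n → ℝ)) (M t *ᵥ 0) s t := by
    intro t s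
    simpa using hasDerivWithinAt_const (F := Fin n → ℝ) t s 0
  -- Comparison with the zero solution, backwards from `u` in the first case and forwards in the
  -- second. Both directions matter, as `Φg` is normalised at the final time.
  rcases le_total t u with h | h
  · have hsub : Set.Icc t u ⊆ Set.Icc 0 T := Set.Icc_subset_Icc ht.1 hu.2
    refine ODE_solution_unique_of_mem_Icc_left (v := fun t x => M t *ᵥ x) (K := c.toNNReal)
      (s := fun _ => Set.univ) (a := t) (b := u) (f := y) (g := fun _ => 0)
      (fun r hr => hlip r (hsub (Set.Ioc_subset_Icc_self hr))) (hcont.mono hsub) (fun r hr => ?_)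
      (fun _ _ => trivial) continuousOn_const (fun r _ => hzero r _) (fun _ _ => trivial) hyu
      (Set.left_mem_Icc.2 h)
    refine ((hy r (hsub (Set.Ioc_subset_Icc_self hr))).mono hsub).mono_of_mem_nhdsWithin ?_
    exact Icc_mem_nhdsLE_of_mem hr
  · have hsub : Set.Icc u t ⊆ Set.Icc 0 T := Set.Icc_subset_Icc hu.1 ht.2
    refine ODE_solution_unique_of_mem_Icc_right (v := fun t x => M t *ᵥ x) (K := c.toNNReal)
      (s := fun _ => Set.univ) (a := u) (b := t) (f := y) (g := fun _ => 0)
      (fun r hr => hlip r (hsub (Set.Ico_subset_Icc_self hr))) (hcont.mono hsub) (fun r hr => ?_)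
      (fun _ _ => trivial) continuousOn_const (fun r _ => hzero r _) (fun _ _ => trivial) hyu
      (Set.right_mem_Icc.2 h)
    refine ((hy r (hsub (Set.Ico_subset_Icc_self hr))).mono hsub).mono_of_mem_nhdsWithin ?_
    exact Icc_mem_nhdsGE_of_mem hr

/-- A fundamental matrix of a linear differential equation is invertible at all times. -/
theorem MatrixODE.isUnit {M Φ : ℝ → Matrix (Fin n) (Fin n) ℝ}
    (hΦ : MatrixODE T Φ fun t => M t * Φ t) (hM : ContinuousOn M (Set.Icc 0 T))
    {u : ℝ} (hu : u ∈ Set.Icc 0 T) (hΦu : Φ u = 1) {t : ℝ} (ht : t ∈ Set.Icc 0 T) :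
    IsUnit (Φ t) := by
  -- If `Φ t` identifies `a` and `b`, then `Φ r *ᵥ (a - b)` is a solution vanishing at `t`, hence
  -- also at `u`, where it equals `a - b`.
  refine Matrix.mulVec_injective_iff_isUnit.1 fun a b hab => ?_
  have h0 : Φ t *ᵥ (a - b) = 0 := by
    rw [Matrix.mulVec_sub, sub_eq_zero]
    exact hab
  have hy : ∀ r ∈ Set.Icc 0 T, HasDerivWithinAt (fun r => Φ r *ᵥ (a - b))
      (M r *ᵥ (Φ r *ᵥ (a - b))) (Set.Icc 0 T) r := by
    intro r hr
    rw [Matrix.mulVec_mulVec, hasDerivWithinAt_pi]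
    intro i
    simp only [Matrix.mulVec, dotProduct]
    exact HasDerivWithinAt.fun_sum fun j _ => (hΦ r hr i j).mul_const ((a - b) j)
  have := eq_zero_of_linear_ode hM hy ht h0 hu
  rw [hΦu, Matrix.one_mulVec, sub_eq_zero] at this
  exact this

theorem _root_.ContinuousOn.matrix_inv {Φ : ℝ → Matrix (Fin n) (Fin n) ℝ} {s : Set ℝ}
    (hΦ : ContinuousOn Φ s) (h : ∀ t ∈ s, IsUnit (Φ t)) : ContinuousOn (fun t => (Φ t)⁻¹) s := by
  intro t ht
  have hdet : (Φ t).det ≠ 0 := ((Matrix.isUnit_iff_isUnit_det _).1 (h t ht)).ne_zero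
  have hinv : ContinuousAt (Ring.inverse : ℝ → ℝ) (Φ t).det := by
    rw [Ring.inverse_eq_inv']
    exact continuousAt_inv₀ hdet
  exact (continuousAt_matrix_inv (Φ t) hinv).comp_continuousWithinAt (hΦ t ht)

/-- The inverse `Ψ` of a fundamental matrix of `x' = M x` satisfies `Ψ' = - Ψ M`. -/
theorem MatrixODE.hasDerivWithinAt_inv {M Φ : ℝ → Matrix (Fin n) (Fin n) ℝ}
    (hΦ : MatrixODE T Φ fun t => M t * Φ t) {t : ℝ} (ht : t ∈ Set.Icc 0 T) (hu : IsUnit (Φ t)) :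
    HasDerivWithinAt (fun r => (Φ r)⁻¹) (-((Φ t)⁻¹ * M t)) (Set.Icc 0 T) t := by
  obtain ⟨U, hU⟩ := hu
  -- The derivative of inversion at `Φ` is `V ↦ -Φ⁻¹ V Φ⁻¹`; for `V = M Φ` this is `-Φ⁻¹ M`.
  have h1 := hasFDerivAt_ringInverse (𝕜 := ℝ) U
  rw [hU] at h1
  have h2 := h1.comp_hasDerivWithinAt t (hΦ.hasDerivWithinAt ht)
  have hUinv : (↑U⁻¹ : Matrix (Fin n) (Fin n) ℝ) = (Φ t)⁻¹ := by
    rw [Matrix.coe_units_inv, hU]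
  have hdet := (Matrix.isUnit_iff_isUnit_det _).1 (⟨U, hU⟩ : IsUnit (Φ t))
  convert! h2 using 1
  · funext r
    exact Matrix.nonsing_inv_eq_ringInverse _
  · simp only [hUinv, neg_apply, ContinuousLinearMap.mulLeftRight_apply]
    rw [Matrix.mul_assoc, Matrix.mul_assoc, Matrix.mul_nonsing_inv _ hdet, Matrix.mul_one]

theorem MatrixODE.inv {M Φ : ℝ → Matrix (Fin n) (Fin n) ℝ}
    (hΦ : MatrixODE T Φ fun t => M t * Φ t) (hu : ∀ t ∈ Set.Icc 0 T, IsUnit (Φ t)) :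
    MatrixODE T (fun t => (Φ t)⁻¹) fun t => -((Φ t)⁻¹ * M t) := fun t ht i j =>
  hasDerivWithinAt_pi.1 (hasDerivWithinAt_pi.1 (hΦ.hasDerivWithinAt_inv ht (hu t ht)) i) j

end MatrixCalculus

/-! ### Continuity of matrix expressions on a set. -/

section ContinuousOn

variable {ι κ ν : Type} [Fintype κ] {s : Set ℝ}

theorem _root_.ContinuousOn.matrix_mul {M : ℝ → Matrix ι κ ℝ} {N : ℝ → Matrix κ ν ℝ}
    (hM : ContinuousOn M s) (hN : ContinuousOn N s) : ContinuousOn (fun t => M t * N t) s :=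
  continuousOn_iff_continuous_domRestrict.2 <|
    (continuousOn_iff_continuous_domRestrict.1 hM).matrix_mul
      (continuousOn_iff_continuous_domRestrict.1 hN)

theorem _root_.ContinuousOn.matrix_mulVec {M : ℝ → Matrix ι κ ℝ} {v : ℝ → κ → ℝ}
    (hM : ContinuousOn M s) (hv : ContinuousOn v s) : ContinuousOn (fun t => M t *ᵥ v t) s :=
  continuousOn_iff_continuous_domRestrict.2 <|
    (continuousOn_iff_continuous_domRestrict.1 hM).matrix_mulVec
      (continuousOn_iff_continuous_domRestrict.1 hv)

theorem _root_.ContinuousOn.vecMul {v : ℝ → κ → ℝ} {M : ℝ → Matrix κ ν ℝ}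
    (hv : ContinuousOn v s) (hM : ContinuousOn M s) : ContinuousOn (fun t => v t ᵥ* M t) s :=
  continuousOn_iff_continuous_domRestrict.2 <|
    (continuousOn_iff_continuous_domRestrict.1 hv).matrix_vecMul
      (continuousOn_iff_continuous_domRestrict.1 hM)

theorem _root_.ContinuousOn.dotProduct {v w : ℝ → κ → ℝ}
    (hv : ContinuousOn v s) (hw : ContinuousOn w s) : ContinuousOn (fun t => v t ⬝ᵥ w t) s :=
  continuousOn_iff_continuous_domRestrict.2 <|
    Continuous.dotProduct (continuousOn_iff_continuous_domRestrict.1 hv)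
      (continuousOn_iff_continuous_domRestrict.1 hw)

theorem _root_.ContinuousOn.matrix_elem {M : ℝ → Matrix ι ν ℝ} (hM : ContinuousOn M s) (i : ι)
    (j : ν) : ContinuousOn (fun t => M t i j) s :=
  continuousOn_pi.1 (continuousOn_pi.1 hM i) j

theorem continuousOn_matrixIntegral {T a : ℝ} {M : ℝ → Matrix ι ν ℝ} (ha : a ∈ Set.Icc 0 T)
    (hM : ContinuousOn M (Set.Icc 0 T)) :
    ContinuousOn (fun t => matrixIntegral a t M) (Set.Icc 0 T) := by
  refine continuousOn_pi.2 fun i => continuousOn_pi.2 fun j => ?_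
  have h0 : (0 : ℝ) ≤ T := ha.1.trans ha.2
  have hint : IntervalIntegrable (fun t => M t i j) volume 0 T :=
    (hM.matrix_elem i j).intervalIntegrable_of_Icc h0
  have := intervalIntegral.continuousOn_primitive_interval' hint
    (a := a) (by rwa [Set.uIcc_of_le h0])
  rwa [Set.uIcc_of_le h0] at this

end ContinuousOn

/-! ### Linearity of entrywise integrals. -/

section Integrals

variable {ι κ : Type} {a b : ℝ}

theorem matrixIntegral_mulVec [Fintype κ] {M : ℝ → Matrix ι κ ℝ} (hab : a ≤ b)
    (hM : ContinuousOn M (Set.Icc a b)) (v : κ → ℝ) :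
    matrixIntegral a b M *ᵥ v = vectorIntegral a b fun u => M u *ᵥ v := by
  funext i
  simp only [matrixIntegral, vectorIntegral, Matrix.mulVec, dotProduct, Matrix.of_apply]
  rw [intervalIntegral.integral_finsetSum]
  · exact Finset.sum_congr rfl fun j _ => (intervalIntegral.integral_mul_const _ _).symm
  · intro j _
    exact ((hM.matrix_elem i j).intervalIntegrable_of_Icc hab).mul_const _

theorem dotProduct_vectorIntegral [Fintype κ] {f : ℝ → κ → ℝ} (hab : a ≤ b)
    (hf : ContinuousOn f (Set.Icc a b)) (v : κ → ℝ) :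
    v ⬝ᵥ vectorIntegral a b f = ∫ u in a..b, v ⬝ᵥ f u := by
  simp only [vectorIntegral, dotProduct]
  rw [intervalIntegral.integral_finsetSum]
  · exact Finset.sum_congr rfl fun j _ => (intervalIntegral.integral_const_mul _ _).symm
  · intro j _
    exact ((continuousOn_pi.1 hf j).intervalIntegrable_of_Icc hab).const_mul _

theorem vectorIntegral_add {f g : ℝ → κ → ℝ} (hab : a ≤ b)
    (hf : ContinuousOn f (Set.Icc a b)) (hg : ContinuousOn g (Set.Icc a b)) :
    vectorIntegral a b (fun u => f u + g u) = vectorIntegral a b f + vectorIntegral a b g := by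
  funext i
  exact intervalIntegral.integral_add ((continuousOn_pi.1 hf i).intervalIntegrable_of_Icc hab)
    ((continuousOn_pi.1 hg i).intervalIntegrable_of_Icc hab)

end Integrals

/-! ### Continuity of the coefficients of the private trajectory. -/

namespace Profile.Solves

variable {n m : ℕ} {p : Profile n} {Θ : Parameters n m} {T : ℝ} {zi0 : Fin n → ℝ}

theorem continuousOn_closedLoop (hp : p.Solves Θ T zi0) :
    ContinuousOn (p.closedLoop Θ) (Set.Icc 0 T) :=
  continuousOn_const.sub (continuousOn_const.matrix_mul hp.P1_ode.continuousOn)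

theorem isUnit_Φx (hp : p.Solves Θ T zi0) {t : ℝ} (ht : t ∈ Set.Icc 0 T) : IsUnit (p.Φx t) :=
  hp.Φx_ode.isUnit hp.continuousOn_closedLoop (Set.left_mem_Icc.2 (ht.1.trans ht.2)) hp.Φx_init ht

theorem continuousOn_Φx_inv (hp : p.Solves Θ T zi0) :
    ContinuousOn (fun t => (p.Φx t)⁻¹) (Set.Icc 0 T) :=
  hp.Φx_ode.continuousOn.matrix_inv fun _ => hp.isUnit_Φx

theorem continuousOn_Φz_inv (hp : p.Solves Θ T zi0) :
    ContinuousOn (fun t => (p.Φz t)⁻¹) (Set.Icc 0 T) := by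
  refine hp.Φz_ode.continuousOn.matrix_inv fun t ht => ?_
  exact hp.Φz_ode.isUnit
    (continuousOn_const.sub (continuousOn_const.matrix_mul hp.P1_ode.continuousOn))
    (Set.left_mem_Icc.2 (ht.1.trans ht.2)) hp.Φz_init ht

theorem continuousOn_Φg_inv (hp : p.Solves Θ T zi0) :
    ContinuousOn (fun t => (p.Φg t)⁻¹) (Set.Icc 0 T) := by
  refine hp.Φg_ode.continuousOn.matrix_inv fun t ht => ?_
  have hode : MatrixODE T p.Φg fun t =>
      (-(Θ.Aᵀ - p.P1 t * (Θ.B + Θ.F) * Θ.gain)) * p.Φg t := by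
    simpa only [Matrix.neg_mul] using hp.Φg_ode
  exact hode.isUnit (continuousOn_const.sub ((hp.P1_ode.continuousOn.matrix_mul
    continuousOn_const).matrix_mul continuousOn_const)).neg
    (Set.right_mem_Icc.2 (ht.1.trans ht.2)) hp.Φg_final ht

theorem continuousOn_Mg (hp : p.Solves Θ T zi0) : ContinuousOn (p.Mg Θ T) (Set.Icc 0 T) := by
  rcases lt_or_ge T 0 with hT | hT
  · simp [Set.Icc_eq_empty (not_le.2 hT)]
  refine (hp.Φg_ode.continuousOn.matrix_mul (continuousOn_const.add
    (continuousOn_matrixIntegral (Set.right_mem_Icc.2 hT) ?_))).neg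
  exact ((hp.continuousOn_Φg_inv.matrix_mul (((hp.P1_ode.continuousOn.matrix_mul
    continuousOn_const).sub (((hp.P1_ode.continuousOn.matrix_mul continuousOn_const).matrix_mul
    continuousOn_const).matrix_mul hp.P1_ode.continuousOn)).sub continuousOn_const)).matrix_mul
    hp.Φ1_ode.continuousOn).matrix_mul continuousOn_const

theorem continuousOn_Mz (hp : p.Solves Θ T zi0) : ContinuousOn (p.Mz Θ T) (Set.Icc 0 T) := by
  rcases lt_or_ge T 0 with hT | hT
  · simp [Set.Icc_eq_empty (not_le.2 hT)]
  refine (hp.Φz_ode.continuousOn.matrix_mul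
    (continuousOn_matrixIntegral (Set.left_mem_Icc.2 hT) ?_)).neg
  exact ((hp.continuousOn_Φz_inv.matrix_mul continuousOn_const).matrix_mul
    continuousOn_const).matrix_mul hp.continuousOn_Mg

theorem continuousOn_Kbar (hp : p.Solves Θ T zi0) : ContinuousOn (p.Kbar Θ T) (Set.Icc 0 T) :=
  ((continuousOn_const.sub (continuousOn_const.matrix_mul hp.P1_ode.continuousOn)).matrix_mul
    hp.continuousOn_Mz).sub (continuousOn_const.matrix_mul hp.continuousOn_Mg)

theorem continuousOn_Ki (hp : p.Solves Θ T zi0) : ContinuousOn (p.Ki Θ T) (Set.Icc 0 T) :=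
  (continuousOn_const.matrix_mul hp.continuousOn_Mg).sub
    (((continuousOn_const.sub (continuousOn_const.matrix_mul hp.P1_ode.continuousOn)).matrix_mul
      hp.Φ1_ode.continuousOn).matrix_mul continuousOn_const)

theorem continuousOn_K (hp : p.Solves Θ T zi0) : ContinuousOn (p.K Θ T) (Set.Icc 0 T) := by
  refine continuousOn_pi.2 fun i => continuousOn_pi.2 fun j => ?_
  cases j with
  | inl j => exact hp.continuousOn_Kbar.matrix_elem i j
  | inr j => exact hp.continuousOn_Ki.matrix_elem i j

theorem continuousOn_inhomogeneity (hp : p.Solves Θ T zi0) :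
    ContinuousOn (p.inhomogeneity Θ) (Set.Icc 0 T) :=
  ((continuousOn_const.sub (continuousOn_const.matrix_mul hp.P1_ode.continuousOn)).matrix_mulVec
    hp.z_ode.continuousOn).sub (continuousOn_const.matrix_mulVec hp.g_ode.continuousOn)

end Profile.Solves

/-! ### The affine form of the drift and the noiseless solution. -/

variable {n m : ℕ}

theorem Profile.drift_eq (p : Profile n) (Θ : Parameters n m) (T : ℝ) (Ebar Ei : Fin n → ℝ)
    (t : ℝ) (x : Fin n → ℝ) :
    p.drift Θ T Ebar Ei t x = p.closedLoop Θ t *ᵥ x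
      + (p.inhomogeneity Θ t + p.K Θ T t *ᵥ stackedError Ebar Ei) := by
  simp only [Profile.drift, Profile.closedLoop, Profile.inhomogeneity, Profile.K, stackedError,
    Matrix.fromCols_mulVec_sumElim]
  abel

/-- The mean is the variation of constants formula for the noiseless equation. -/
theorem Profile.Solves.mean_eq {p : Profile n} {Θ : Parameters n m} {T : ℝ} {zi0 : Fin n → ℝ}
    (hp : p.Solves Θ T zi0) (Ebar Ei : Fin n → ℝ) {s t : ℝ} (hs : 0 ≤ s) (hst : s ≤ t)
    (ht : t ≤ T) (x : EuclideanSpace ℝ (Fin n)) :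
    (p.mean Θ T Ebar Ei s t x).ofLp = (p.Φx t * (p.Φx s)⁻¹) *ᵥ x.ofLp
      + p.Φx t *ᵥ vectorIntegral s t fun u => (p.Φx u)⁻¹ *ᵥ
        (p.inhomogeneity Θ u + p.K Θ T u *ᵥ stackedError Ebar Ei) := by
  have hsub : Set.Icc s t ⊆ Set.Icc 0 T := Set.Icc_subset_Icc hs ht
  have hΦ := hp.continuousOn_Φx_inv.mono hsub
  have hK := hp.continuousOn_K.mono hsub
  have hB := hp.continuousOn_inhomogeneity.mono hsub
  simp only [Profile.mean, Profile.freeMean, Matrix.mulVec_add]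
  rw [vectorIntegral_add hst (hΦ.matrix_mulVec hB)
    (hΦ.matrix_mulVec (hK.matrix_mulVec continuousOn_const)), Matrix.mulVec_add,
    ← Matrix.mulVec_mulVec _ (p.Φx t) (matrixIntegral _ _ _),
    matrixIntegral_mulVec hst (hΦ.matrix_mul hK)]
  simp only [Matrix.mulVec_mulVec, add_assoc]

end ErroneousMFG

/-! ### Pathwise Riemann–Stieltjes sums. -/

section RiemannStieltjes

open Filter Topology

/-- The `j`-th point of the partition of `[s,t]` into `k + 1` intervals of equal length. -/
noncomputable def uniformPartition (s t : ℝ) (k j : ℕ) : ℝ := s + j / (k + 1) * (t - s)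

variable {s t : ℝ}

theorem uniformPartition_zero (s t : ℝ) (k : ℕ) : uniformPartition s t k 0 = s := by
  simp [uniformPartition]

theorem uniformPartition_last (s t : ℝ) (k : ℕ) : uniformPartition s t k (k + 1) = t := by
  have : (k : ℝ) + 1 ≠ 0 := by positivity
  simp [uniformPartition, div_self this]

theorem uniformPartition_mono (hst : s ≤ t) (k : ℕ) : Monotone (uniformPartition s t k) := by
  intro i j hij
  have := sub_nonneg.2 hst
  unfold uniformPartition
  gcongr

theorem uniformPartition_succ_sub (s t : ℝ) (k j : ℕ) :
    uniformPartition s t k (j + 1) - uniformPartition s t k j = (t - s) / (k + 1) := by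
  simp only [uniformPartition]
  push_cast
  ring

theorem uniformPartition_mem (hst : s ≤ t) {k j : ℕ} (hj : j ≤ k + 1) :
    uniformPartition s t k j ∈ Set.Icc s t := by
  constructor
  · simpa only [uniformPartition_zero] using uniformPartition_mono hst k (Nat.zero_le j)
  · simpa only [uniformPartition_last] using uniformPartition_mono hst k hj

/-- Riemann–Stieltjes sums against a continuously differentiable integrator converge. -/
theorem tendsto_sum_mul_sub_of_hasDerivWithinAt {f g g' : ℝ → ℝ} (hst : s ≤ t)
    (hf : ContinuousOn f (Set.Icc s t))
    (hg : ∀ v ∈ Set.Icc s t, HasDerivWithinAt g (g' v) (Set.Icc s t) v)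
    (hg' : ContinuousOn g' (Set.Icc s t)) {c : ℕ → ℕ → ℝ}
    (hc : ∀ k j, j < k + 1 →
      c k j ∈ Set.Icc (uniformPartition s t k j) (uniformPartition s t k (j + 1))) :
    Tendsto (fun k => ∑ j ∈ Finset.range (k + 1), f (c k j) *
      (g (uniformPartition s t k (j + 1)) - g (uniformPartition s t k j))) atTop
      (𝓝 (∫ v in s..t, f v * g' v)) := by
  obtain ⟨C₀, hC₀⟩ := isCompact_Icc.exists_bound_of_continuousOn hg'
  set C := |C₀| + 1
  have hCpos : 0 < C := by positivity
  have hC : ∀ v ∈ Set.Icc s t, ‖g' v‖ ≤ C := fun v hv =>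
    (hC₀ v hv).trans ((le_abs_self _).trans (le_add_of_nonneg_right zero_le_one))
  rw [Metric.tendsto_atTop]
  intro ε hε
  -- The added `1`, like the one in `C`, keeps the divisor in `ε'` positive when `s = t` or `g' =
  -- 0`.
  have hlen : 0 < t - s + 1 := by linarith
  set ε' := ε / (C * (t - s + 1))
  have hε' : 0 < ε' := by positivity
  obtain ⟨δ, hδ, hfδ⟩ := Metric.uniformContinuousOn_iff.1
    (isCompact_Icc.uniformContinuousOn_of_continuous hf) ε' hε'
  obtain ⟨N, hN⟩ := exists_nat_gt ((t - s) / δ)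
  refine ⟨N, fun k hk => ?_⟩
  have hmesh : (t - s) / (k + 1) < δ := by
    rw [div_lt_iff₀ (by positivity)]
    rw [div_lt_iff₀ hδ] at hN
    have : (N : ℝ) ≤ k := by exact_mod_cast hk
    nlinarith
  have hsub : ∀ j < k + 1, Set.Icc (uniformPartition s t k j) (uniformPartition s t k (j + 1))
      ⊆ Set.Icc s t := fun j hj => Set.Icc_subset_Icc
    (uniformPartition_mem hst hj.le).1 (uniformPartition_mem hst hj).2
  have hle : ∀ j, uniformPartition s t k j ≤ uniformPartition s t k (j + 1) := fun j =>
    uniformPartition_mono hst k j.le_succ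
  have hint : ∀ j < k + 1, IntervalIntegrable (fun v => f v * g' v) volume
      (uniformPartition s t k j) (uniformPartition s t k (j + 1)) := fun j hj =>
    ((hf.mul hg').mono (hsub j hj)).intervalIntegrable_of_Icc (hle j)
  have hsum := intervalIntegral.sum_integral_adjacent_intervals hint
  rw [uniformPartition_zero, uniformPartition_last] at hsum
  rw [dist_eq_norm, ← hsum, ← Finset.sum_sub_distrib]
  -- On one cell the increment of `g` is `∫ g'`, so the error is `∫ (f(c) - f(v)) g'(v) dv`, where
  -- uniform continuity bounds the first factor by `ε'`.
  have hterm : ∀ j ∈ Finset.range (k + 1),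
      ‖f (c k j) * (g (uniformPartition s t k (j + 1)) - g (uniformPartition s t k j))
        - ∫ v in uniformPartition s t k j..uniformPartition s t k (j + 1), f v * g' v‖
      ≤ ε' * C * (uniformPartition s t k (j + 1) - uniformPartition s t k j) := by
    intro j hj
    have hj := Finset.mem_range.1 hj
    have hg'j := (hg'.mono (hsub j hj)).intervalIntegrable_of_Icc (μ := volume) (hle j)
    have hftc : ∫ v in uniformPartition s t k j..uniformPartition s t k (j + 1), g' v
        = g (uniformPartition s t k (j + 1)) - g (uniformPartition s t k j) := by
      refine intervalIntegral.integral_eq_sub_of_hasDerivAt_of_le (hle j)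
        (fun v hv => (hg v (hsub j hj hv)).continuousWithinAt.mono (hsub j hj)) ?_ hg'j
      intro v hv
      exact ((hg v (hsub j hj (Set.Ioo_subset_Icc_self hv))).mono (hsub j hj)).hasDerivAt
        (Icc_mem_nhds hv.1 hv.2)
    rw [← hftc, ← intervalIntegral.integral_const_mul,
      ← intervalIntegral.integral_sub (hg'j.const_mul _) (hint j hj)]
    refine (intervalIntegral.norm_integral_le_of_norm_le_const (C := ε' * C) ?_).trans ?_
    · intro v hv
      rw [Set.uIoc_of_le (hle j)] at hv
      have hv' := Set.Ioc_subset_Icc_self hv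
      rw [← sub_mul, norm_mul]
      refine mul_le_mul ?_ (hC v (hsub j hj hv')) (norm_nonneg _) hε'.le
      rw [← dist_eq_norm]
      refine (hfδ _ (hsub j hj (hc k j hj)) _ (hsub j hj hv') ?_).le
      refine (Real.dist_le_of_mem_Icc (hc k j hj) hv').trans_lt ?_
      rwa [uniformPartition_succ_sub]
    · rw [abs_of_nonneg (sub_nonneg.2 (hle j))]
  refine (norm_sum_le_of_le _ hterm).trans_lt ?_
  rw [← Finset.mul_sum, Finset.sum_range_sub, uniformPartition_zero, uniformPartition_last]
  have : ε' * C * (t - s + 1) = ε := by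
    simp only [ε']
    field_simp
  have : 0 < ε' * C := by positivity
  nlinarith

theorem tendsto_riemann_sum {f : ℝ → ℝ} (hst : s ≤ t) (hf : ContinuousOn f (Set.Icc s t)) :
    Tendsto (fun k => ∑ j ∈ Finset.range (k + 1), f (uniformPartition s t k j) *
      (uniformPartition s t k (j + 1) - uniformPartition s t k j)) atTop
      (𝓝 (∫ v in s..t, f v)) := by
  simpa using tendsto_sum_mul_sub_of_hasDerivWithinAt (g := id) (g' := fun _ => 1) hst hf
    (fun v _ => hasDerivWithinAt_id v _) continuousOn_const
    (fun k j _ => Set.left_mem_Icc.2 (uniformPartition_mono hst k j.le_succ))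

/-- Riemann–Stieltjes sums of a continuously differentiable function against a continuous
integrator converge to the expression given by integration by parts. -/
theorem tendsto_sum_mul_sub_of_continuousOn {w h h' : ℝ → ℝ} (hst : s ≤ t)
    (hw : ContinuousOn w (Set.Icc s t))
    (hh : ∀ v ∈ Set.Icc s t, HasDerivWithinAt h (h' v) (Set.Icc s t) v)
    (hh' : ContinuousOn h' (Set.Icc s t)) :
    Tendsto (fun k => ∑ j ∈ Finset.range (k + 1), h (uniformPartition s t k j) *
      (w (uniformPartition s t k (j + 1)) - w (uniformPartition s t k j))) atTop
      (𝓝 (h t * w t - h s * w s - ∫ v in s..t, w v * h' v)) := by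
  -- Summation by parts turns sums of `h dw` with left tags into sums of `w dh` with right tags,
  -- hence the right end points here.
  have key := (tendsto_sum_mul_sub_of_hasDerivWithinAt hst hw hh hh'
    (fun k j _ => Set.right_mem_Icc.2 (uniformPartition_mono hst k j.le_succ))).const_sub
      (h t * w t - h s * w s)
  refine key.congr fun k => ?_
  have abel : ∀ (a b : ℕ → ℝ) (K : ℕ), ∑ j ∈ Finset.range K, a j * (b (j + 1) - b j)
      = a K * b K - a 0 * b 0 - ∑ j ∈ Finset.range K, b (j + 1) * (a (j + 1) - a j) := by
    intro a b K
    induction K with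
    | zero => simp
    | succ K ih =>
      rw [Finset.sum_range_succ, Finset.sum_range_succ, ih]
      ring
  have := abel (fun j => h (uniformPartition s t k j)) (fun j => w (uniformPartition s t k j))
    (k + 1)
  simp only [uniformPartition_zero, uniformPartition_last] at this
  exact this.symm

end RiemannStieltjes

namespace ErroneousMFG

/-! ### Variation of constants along a continuous driving path. -/

section VariationOfConstants

open Filter Topology

variable {n : ℕ} {s t : ℝ}

theorem vectorIntegral_self {ι : Type} (a : ℝ) (v : ℝ → ι → ℝ) : vectorIntegral a a v = 0 := by
  funext i
  simp [vectorIntegral]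

theorem continuousOn_vectorIntegral {ι : Type} {q : ℝ → ι → ℝ} (hst : s ≤ t)
    (hq : ContinuousOn q (Set.Icc s t)) :
    ContinuousOn (fun u => vectorIntegral s u q) (Set.Icc s t) := by
  refine continuousOn_pi.2 fun i => ?_
  have hint : IntervalIntegrable (fun v => q v i) volume s t :=
    (continuousOn_pi.1 hq i).intervalIntegrable_of_Icc hst
  have := intervalIntegral.continuousOn_primitive_interval' hint (a := s) Set.left_mem_uIcc
  rwa [Set.uIcc_of_le hst] at this

theorem hasDerivAt_vectorIntegral {ι : Type} {q : ℝ → ι → ℝ}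
    (hq : ContinuousOn q (Set.Icc s t)) {u : ℝ} (hu : u ∈ Set.Ioo s t) (i : ι) :
    HasDerivAt (fun r => vectorIntegral s r q i) (q u i) u := by
  have hqi := continuousOn_pi.1 hq i
  refine intervalIntegral.integral_hasDerivAt_right ?_ ?_ ?_
  · exact (hqi.mono (Set.Icc_subset_Icc_right hu.2.le)).intervalIntegrable_of_Icc hu.1.le
  · exact (hqi.mono Set.Ioo_subset_Icc_self).stronglyMeasurableAtFilter isOpen_Ioo _ hu
  · exact hqi.continuousAt (Icc_mem_nhds hu.1 hu.2)

variable {M : ℝ → Matrix (Fin n) (Fin n) ℝ} {D : Matrix (Fin n) (Fin n) ℝ}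
  {b x w h : ℝ → Fin n → ℝ}

/-- Variation of constants for `dx = (M x + b) dt + D dw` with a continuous driving path `w`, tested
against a solution `h` of the adjoint equation. -/
theorem dotProduct_eq_of_integral_equation (hst : s ≤ t) (hM : ContinuousOn M (Set.Icc s t))
    (hb : ContinuousOn b (Set.Icc s t)) (hx : ContinuousOn x (Set.Icc s t))
    (hw : ContinuousOn w (Set.Icc s t))
    (heq : ∀ u ∈ Set.Icc s t,
      x u = x s + vectorIntegral s u (fun v => M v *ᵥ x v + b v) + D *ᵥ w u)
    (hh : ∀ v ∈ Set.Icc s t, ∀ i,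
      HasDerivWithinAt (fun v => h v i) ((-(h v ᵥ* M v)) i) (Set.Icc s t) v) :
    h t ⬝ᵥ x t = h s ⬝ᵥ x s + (∫ v in s..t, h v ⬝ᵥ b v)
      + ((h t ᵥ* D) ⬝ᵥ w t + ∫ v in s..t, (h v ᵥ* M v ᵥ* D) ⬝ᵥ w v) := by
  set q : ℝ → Fin n → ℝ := fun v => M v *ᵥ x v + b v with hqdef
  have hq : ContinuousOn q (Set.Icc s t) := (hM.matrix_mulVec hx).add hb
  have hhc : ContinuousOn h (Set.Icc s t) :=
    continuousOn_pi.2 fun i v hv => (hh v hv i).continuousWithinAt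
  have hY := continuousOn_vectorIntegral hst hq
  -- Subtracting the rough part `D w` leaves an integral of a continuous function, to which the
  -- product rule applies.
  have hYeq : ∀ u ∈ Set.Icc s t, x s + vectorIntegral s u q = x u - D *ᵥ w u := by
    intro u hu
    rw [eq_sub_iff_add_eq]
    exact (heq u hu).symm
  have hF : ContinuousOn (fun u => h u ⬝ᵥ (x s + vectorIntegral s u q)) (Set.Icc s t) :=
    hhc.dotProduct (continuousOn_const.add hY)
  have hc1 : ContinuousOn (fun v => h v ⬝ᵥ b v) (Set.Icc s t) := hhc.dotProduct hb
  have hc2 : ContinuousOn (fun v => (h v ᵥ* M v ᵥ* D) ⬝ᵥ w v) (Set.Icc s t) :=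
    ((hhc.vecMul hM).vecMul continuousOn_const).dotProduct hw
  -- The derivative is `-h M · (x - D w) + h · (M x + b)`; the terms in `M x` cancel by the adjoint
  -- equation.
  have hder : ∀ u ∈ Set.Ioo s t,
      HasDerivAt (fun u => h u ⬝ᵥ (x s + vectorIntegral s u q))
        (h u ⬝ᵥ b u + (h u ᵥ* M u ᵥ* D) ⬝ᵥ w u) u := by
    intro u hu
    have hu' := Set.Ioo_subset_Icc_self hu
    have h1 : HasDerivAt (fun u => h u ⬝ᵥ (x s + vectorIntegral s u q))
        (∑ i, ((-(h u ᵥ* M u)) i * (x s + vectorIntegral s u q) i + h u i * q u i)) u := by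
      simp only [dotProduct]
      refine HasDerivAt.fun_sum fun i _ => ?_
      exact ((hh u hu' i).hasDerivAt (Icc_mem_nhds hu.1 hu.2)).mul
        ((hasDerivAt_vectorIntegral hq hu i).const_add (x s i))
    convert h1 using 1
    rw [Finset.sum_add_distrib, hYeq u hu']
    change _ = (-(h u ᵥ* M u)) ⬝ᵥ (x u - D *ᵥ w u) + h u ⬝ᵥ q u
    simp only [hqdef, Matrix.neg_vecMul, neg_dotProduct, dotProduct_sub, dotProduct_add,
      Matrix.dotProduct_mulVec]
    ring
  have hint := intervalIntegral.integral_eq_sub_of_hasDerivAt_of_le hst hF hder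
    ((hc1.add hc2).intervalIntegrable_of_Icc hst)
  rw [intervalIntegral.integral_add (hc1.intervalIntegrable_of_Icc hst)
    (hc2.intervalIntegrable_of_Icc hst), hYeq t (Set.right_mem_Icc.2 hst), vectorIntegral_self,
    add_zero, dotProduct_sub, Matrix.dotProduct_mulVec] at hint
  linarith

/-- The noise part of the solution of `dx = (M x + b) dt + D dw` is a limit of Riemann–Stieltjes
sums against the increments of the driving path `w`. -/
theorem tendsto_sum_vecMul_dotProduct_increment (hst : s ≤ t) (hM : ContinuousOn M (Set.Icc s t))
    (hb : ContinuousOn b (Set.Icc s t)) (hx : ContinuousOn x (Set.Icc s t))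
    (hw : ContinuousOn w (Set.Icc s t)) (hws : w s = 0)
    (heq : ∀ u ∈ Set.Icc s t,
      x u = x s + vectorIntegral s u (fun v => M v *ᵥ x v + b v) + D *ᵥ w u)
    (hh : ∀ v ∈ Set.Icc s t, ∀ i,
      HasDerivWithinAt (fun v => h v i) ((-(h v ᵥ* M v)) i) (Set.Icc s t) v) :
    Tendsto (fun k => ∑ j ∈ Finset.range (k + 1), (h (uniformPartition s t k j) ᵥ* D) ⬝ᵥ
      (w (uniformPartition s t k (j + 1)) - w (uniformPartition s t k j))) atTop
      (𝓝 (h t ⬝ᵥ x t - h s ⬝ᵥ x s - ∫ v in s..t, h v ⬝ᵥ b v)) := by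
  have hhc : ContinuousOn h (Set.Icc s t) :=
    continuousOn_pi.2 fun i v hv => (hh v hv i).continuousWithinAt
  have hc : ContinuousOn (fun v => h v ᵥ* M v ᵥ* D) (Set.Icc s t) :=
    (hhc.vecMul hM).vecMul continuousOn_const
  have hder : ∀ i, ∀ v ∈ Set.Icc s t, HasDerivWithinAt (fun v => (h v ᵥ* D) i)
      (-(h v ᵥ* M v ᵥ* D) i) (Set.Icc s t) v := by
    intro i v hv
    have h1 : HasDerivWithinAt (fun v => (h v ᵥ* D) i)
        (∑ l, (-(h v ᵥ* M v)) l * D l i) (Set.Icc s t) v := by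
      simp only [Matrix.vecMul, dotProduct]
      exact HasDerivWithinAt.fun_sum fun l _ => (hh v hv l).mul_const (D l i)
    convert h1 using 1
    change _ = ((-(h v ᵥ* M v)) ᵥ* D) i
    rw [Matrix.neg_vecMul]
    rfl
  have hcoord := fun i => tendsto_sum_mul_sub_of_continuousOn hst (continuousOn_pi.1 hw i)
    (hder i) (continuousOn_pi.1 hc i).neg
  have hsum := tendsto_finsetSum Finset.univ fun i _ => hcoord i
  -- The coordinatewise limits add up to the noise term of the variation of constants formula; the
  -- boundary term at `s` drops out because `w s = 0`.
  have hlim : ∑ i, ((h t ᵥ* D) i * w t i - (h s ᵥ* D) i * w s i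
      - ∫ v in s..t, w v i * -(h v ᵥ* M v ᵥ* D) i)
      = h t ⬝ᵥ x t - h s ⬝ᵥ x s - ∫ v in s..t, h v ⬝ᵥ b v := by
    rw [dotProduct_eq_of_integral_equation hst hM hb hx hw heq hh]
    simp only [dotProduct, hws, Pi.zero_apply, mul_zero, sub_zero, mul_neg,
      intervalIntegral.integral_neg, sub_neg_eq_add]
    rw [Finset.sum_add_distrib, intervalIntegral.integral_finsetSum (f := fun i v =>
      (h v ᵥ* M v ᵥ* D) i * w v i)]
    · simp only [mul_comm (w _ _)]
      ring
    · intro i _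
      exact ((continuousOn_pi.1 hc i).mul (continuousOn_pi.1 hw i)).intervalIntegrable_of_Icc hst
  rw [hlim] at hsum
  refine hsum.congr fun k => ?_
  rw [Finset.sum_comm]
  rfl

end VariationOfConstants

/-! ### Characteristic functions of Wiener increments. -/

section WienerIncrements

open Complex

variable {n : ℕ} {Ω : Type*} {mΩ : MeasurableSpace Ω} {P : Measure Ω} {𝓕 : Filtration ℝ≥0 mΩ}
  {W : ℝ≥0 → Ω → EuclideanSpace ℝ (Fin n)}

/-- Independence of the coordinates factors the expectation into characteristic functions of
centered real normal laws of variance `t - s`. -/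
theorem IsWienerProcess.integral_cexp_increment (hW : IsWienerProcess P 𝓕 W) (h : Fin n → ℝ)
    {s t : ℝ≥0} (hst : s ≤ t) :
    ∫ ω, cexp ((h ⬝ᵥ (W t ω - W s ω).ofLp : ℝ) * I) ∂P
      = cexp (-(1 / 2) * ((h ⬝ᵥ h) * (t - s) : ℝ)) := by
  have hind : iIndepFun (fun i ω => cexp ((h i * (W t ω i - W s ω i) : ℝ) * I)) P :=
    hW.indep_coords.comp (fun i (f : ℝ≥0 → ℝ) => cexp ((h i * (f t - f s) : ℝ) * I))
      (fun i => by fun_prop)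
  have heval : ∀ i, Measurable fun x : EuclideanSpace ℝ (Fin n) => x i := fun i => by fun_prop
  have hmeas : ∀ u i, Measurable fun ω => W u ω i := fun u i =>
    (heval i).comp ((hW.adapted u).mono (𝓕.le u) le_rfl)
  have hprod : ∀ ω, cexp ((h ⬝ᵥ (W t ω - W s ω).ofLp : ℝ) * I)
      = ∏ i, cexp ((h i * (W t ω i - W s ω i) : ℝ) * I) := by
    intro ω
    rw [← Complex.exp_sum, ← Finset.sum_mul, ← Complex.ofReal_sum]
    rfl
  have hcoord : ∀ i, ∫ ω, cexp ((h i * (W t ω i - W s ω i) : ℝ) * I) ∂P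
      = cexp (-(1 / 2) * ((h i * h i) * (t - s) : ℝ)) := by
    intro i
    have hlaw := (hW.brownian i).hasLaw_sub t s
    -- The variance of a Brownian increment is supplied as the distance of the two times.
    have hd : nndist t.1 s.1 = t - s := by
      ext
      rw [coe_nndist, NNReal.coe_sub hst]
      exact (Real.dist_eq _ _).trans (abs_of_nonneg (sub_nonneg.2 (NNReal.coe_le_coe.2 hst)))
    rw [hd] at hlaw
    have hchar := congrArg (fun μ => charFun μ (h i)) hlaw.map_eq
    simp only [charFun_gaussianReal] at hchar
    rw [charFun_apply_real, integral_map hlaw.aemeasurable (by fun_prop)] at hchar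
    rw [NNReal.coe_sub hst] at hchar
    convert! hchar using 2
    · funext ω
      simp
    · push_cast
      ring
  have hexp : ∀ c : ℝ, Measurable fun x : ℝ => cexp ((c * x : ℝ) * I) := fun c => by fun_prop
  have hae : ∀ i, AEStronglyMeasurable
      (fun ω => cexp ((h i * (W t ω i - W s ω i) : ℝ) * I)) P := fun i =>
    ((hexp (h i)).comp ((hmeas t i).sub (hmeas s i))).aestronglyMeasurable
  simp_rw [hprod]
  rw [hind.integral_fun_prod_eq_prod_integral hae]
  simp_rw [hcoord]
  rw [← Complex.exp_sum, ← Finset.mul_sum, ← Complex.ofReal_sum, ← Finset.sum_mul]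
  rfl

/-- The joint characteristic function of successive increments of a Wiener process on an event of
the past. -/
theorem IsWienerProcess.setIntegral_cexp_sum_increments [IsProbabilityMeasure P]
    (hW : IsWienerProcess P 𝓕 W) {τ : ℕ → ℝ≥0} (hτ : Monotone τ) (h : ℕ → Fin n → ℝ) {A : Set Ω}
    (hA : MeasurableSet[𝓕 (τ 0)] A) (K : ℕ) :
    ∫ ω in A, cexp ((∑ j ∈ Finset.range K, h j ⬝ᵥ (W (τ (j + 1)) ω - W (τ j) ω).ofLp : ℝ) * I) ∂P
      = P.real A *
        cexp (-(1 / 2) * (∑ j ∈ Finset.range K, (h j ⬝ᵥ h j) * (τ (j + 1) - τ j) : ℝ)) := by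
  have hA' : MeasurableSet A := 𝓕.le _ _ hA
  have hWm : ∀ i j, i ≤ j → Measurable[𝓕 (τ j)] (W (τ i)) := fun i j hij =>
    (hW.adapted (τ i)).mono (𝓕.mono (hτ hij)) le_rfl
  have hφ : ∀ v : Fin n → ℝ,
      Measurable fun x : EuclideanSpace ℝ (Fin n) => cexp ((v ⬝ᵥ x.ofLp : ℝ) * I) := by
    intro v
    unfold dotProduct
    fun_prop
  have hterm : ∀ i j, i + 1 ≤ j →
      Measurable[𝓕 (τ j)] fun ω => h i ⬝ᵥ (W (τ (i + 1)) ω - W (τ i) ω).ofLp := by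
    intro i j hij
    have hdot : Measurable fun x : EuclideanSpace ℝ (Fin n) => h i ⬝ᵥ x.ofLp := by
      unfold dotProduct
      fun_prop
    exact hdot.comp ((hWm (i + 1) j hij).sub (hWm i j (Nat.le_of_succ_le hij)))
  induction K with
  | zero => simp
  | succ K ih =>
    -- The event is absorbed into `Z`, which is then measurable for the past of `τ K`, while `Y`
    -- depends only on the next increment. The expectation of the product therefore splits.
    set Z : Ω → ℂ := A.indicator fun ω =>
      cexp ((∑ j ∈ Finset.range K, h j ⬝ᵥ (W (τ (j + 1)) ω - W (τ j) ω).ofLp : ℝ) * I) with hZ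
    set Y : Ω → ℂ := fun ω => cexp ((h K ⬝ᵥ (W (τ (K + 1)) ω - W (τ K) ω).ofLp : ℝ) * I) with hY
    have hZm : Measurable[𝓕 (τ K)] Z := by
      refine Measurable.indicator ?_ (𝓕.mono (hτ (Nat.zero_le K)) _ hA)
      have hsum : Measurable[𝓕 (τ K)] fun ω =>
          ∑ j ∈ Finset.range K, h j ⬝ᵥ (W (τ (j + 1)) ω - W (τ j) ω).ofLp :=
        Finset.measurable_fun_sum _ fun j hj => hterm j K (Finset.mem_range.1 hj)
      have hexp : Measurable fun x : ℝ => cexp (x * I) := by fun_prop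
      exact hexp.comp hsum
    have hincr : Measurable fun ω => W (τ (K + 1)) ω - W (τ K) ω :=
      ((hW.adapted _).mono (𝓕.le _) le_rfl).sub ((hW.adapted _).mono (𝓕.le _) le_rfl)
    have hYm : Measurable Y := (hφ (h K)).comp hincr
    have hindep : IndepFun Z Y P := by
      have h1 : IndepFun (fun ω => W (τ (K + 1)) ω - W (τ K) ω) Z P := by
        rw [IndepFun_iff_Indep]
        exact indep_of_indep_of_le_right (hW.indep_increments _ _ (hτ (Nat.le_add_right K 1)))
          hZm.comap_le
      exact (h1.comp (hφ (h K)) measurable_id).symm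
    have hsplit : ∀ ω, A.indicator (fun ω => cexp ((∑ j ∈ Finset.range (K + 1),
        h j ⬝ᵥ (W (τ (j + 1)) ω - W (τ j) ω).ofLp : ℝ) * I)) ω = (Z * Y) ω := by
      intro ω
      by_cases hω : ω ∈ A
      · simp only [hZ, hY, Pi.mul_apply, Set.indicator_of_mem hω]
        rw [← Complex.exp_add, Finset.sum_range_succ]
        push_cast
        ring_nf
      · simp [hZ, Set.indicator_of_notMem hω]
    rw [← integral_indicator hA', integral_congr_ae (Filter.Eventually.of_forall hsplit),
      hindep.integral_mul_eq_mul_integral (hZm.mono (𝓕.le _) le_rfl).aestronglyMeasurable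
        hYm.aestronglyMeasurable, hZ, integral_indicator hA', ih, hY,
      hW.integral_cexp_increment (h K) (hτ (Nat.le_add_right K 1)), mul_assoc, ← Complex.exp_add,
      Finset.sum_range_succ]
    push_cast
    ring_nf

end WienerIncrements

/-! ### Densities of normal laws. -/

section GaussianDensity

open Complex
open scoped RealInnerProductSpace MatrixOrder

variable {n : ℕ}

/-- The density of the standard normal law. -/
theorem stdGaussian_eq_withDensity :
    stdGaussian (EuclideanSpace ℝ (Fin n)) = volume.withDensity fun x =>
      ENNReal.ofReal (1 / √((2 * Real.pi) ^ n) * Real.exp (-(1 / 2) * ‖x‖ ^ 2)) := by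
  set f : EuclideanSpace ℝ (Fin n) → ℝ :=
    fun x => 1 / √((2 * Real.pi) ^ n) * Real.exp (-(1 / 2) * ‖x‖ ^ 2) with hf
  have hf0 : ∀ x, 0 ≤ f x := fun x => by positivity
  -- Integrability makes the measure with density `f` finite, so that its characteristic function
  -- determines it.
  have hfint : Integrable f := by
    have h1 := (GaussianFourier.integrable_cexp_neg_mul_sq_norm_add (V := EuclideanSpace ℝ (Fin n))
      (b := 1 / 2) (by norm_num) 0 0).norm
    refine (h1.const_mul (1 / √((2 * Real.pi) ^ n))).congr (Filter.Eventually.of_forall fun x => ?_)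
    simp only [hf, Complex.norm_exp]
    congr 2
    simp [← Complex.ofReal_pow]
  have hfm : Measurable fun x => ENNReal.ofReal (f x) := by
    simp only [hf]
    fun_prop
  have : IsFiniteMeasure (volume.withDensity fun x => ENNReal.ofReal (f x)) :=
    isFiniteMeasure_withDensity_ofReal hfint.2
  refine Measure.ext_of_charFun (funext fun t => ?_)
  rw [charFun_stdGaussian, charFun_apply, integral_withDensity_eq_integral_toReal_smul hfm
    (Filter.Eventually.of_forall fun x => ENNReal.ofReal_lt_top)]
  have hint : ∀ x, (ENNReal.ofReal (f x)).toReal • cexp (⟪x, t⟫ * I)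
      = (1 / √((2 * Real.pi) ^ n) : ℝ) * cexp (-(1 / 2 : ℂ) * ‖x‖ ^ 2 + I * ⟪t, x⟫) := by
    intro x
    rw [ENNReal.toReal_ofReal (hf0 x), hf, Complex.real_smul, Complex.exp_add]
    push_cast
    rw [real_inner_comm, mul_comm I, mul_assoc]
  simp_rw [hint]
  rw [integral_const_mul, GaussianFourier.integral_cexp_neg_mul_sq_norm_add (by norm_num)]
  -- The factor produced by the Gaussian integral is exactly the normalising constant.
  have hconst : ((Real.pi : ℂ) / (1 / 2)) ^ ((Module.finrank ℝ (EuclideanSpace ℝ (Fin n)) : ℂ) / 2)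
      = (√((2 * Real.pi) ^ n) : ℝ) := by
    rw [finrank_euclideanSpace_fin, Real.sqrt_eq_rpow, ← Real.rpow_natCast, ← Real.rpow_mul
      (by positivity), Complex.ofReal_cpow (by positivity)]
    push_cast
    congr 1 <;> ring
  have hne : (√((2 * Real.pi) ^ n) : ℝ) ≠ 0 := by positivity
  rw [hconst, ← mul_assoc, ← Complex.ofReal_mul, one_div, inv_mul_cancel₀ hne, Complex.ofReal_one,
    one_mul, Complex.I_sq]
  congr 1
  ring

/-- The density of a nondegenerate multivariate normal law. -/
theorem multivariateGaussian_eq_withDensity (μ : EuclideanSpace ℝ (Fin n))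
    {S : Matrix (Fin n) (Fin n) ℝ} (hS : S.PosSemidef) (hdet : S.det ≠ 0) :
    multivariateGaussian μ S
      = volume.withDensity fun y => ENNReal.ofReal (gaussianDensity μ S y) := by
  -- The normal law is the image of the standard one under `g x = μ + A x`, with `A` the symmetric
  -- root of `S`.
  set A := CFC.sqrt S with hA
  have hAA : A * A = S := CFC.sqrt_mul_sqrt_self _ hS.nonneg
  have hAsymm : Aᵀ = A := by
    have h1 : IsSelfAdjoint A := (CFC.sqrt_nonneg S).isSelfAdjoint
    rw [← Matrix.conjTranspose_eq_transpose_of_trivial]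
    exact h1
  have hdetA : A.det * A.det = S.det := by rw [← Matrix.det_mul, hAA]
  have hA0 : A.det ≠ 0 := by
    intro h0
    rw [h0, zero_mul] at hdetA
    exact hdet hdetA.symm
  set g : EuclideanSpace ℝ (Fin n) → EuclideanSpace ℝ (Fin n) :=
    fun x => μ + Matrix.toEuclideanCLM (𝕜 := ℝ) A x with hg
  have hgm : Measurable g := by fun_prop
  have hmap : (volume : Measure (EuclideanSpace ℝ (Fin n))).map g
      = ENNReal.ofReal |A.det⁻¹| • volume := by
    have hlin : LinearMap.det (Matrix.toEuclideanCLM (𝕜 := ℝ) A :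
        EuclideanSpace ℝ (Fin n) →ₗ[ℝ] EuclideanSpace ℝ (Fin n)) = A.det := by
      exact LinearMap.det_toLin _ _
    have h1 := Measure.map_linearMap_addHaar_eq_smul_addHaar
      (volume : Measure (EuclideanSpace ℝ (Fin n))) (f := (Matrix.toEuclideanCLM (𝕜 := ℝ) A :
        EuclideanSpace ℝ (Fin n) →ₗ[ℝ] EuclideanSpace ℝ (Fin n))) (by rwa [hlin])
    rw [hlin] at h1
    have h2 : g = (fun x => μ + x) ∘ ⇑(Matrix.toEuclideanCLM (𝕜 := ℝ) A :
        EuclideanSpace ℝ (Fin n) →ₗ[ℝ] EuclideanSpace ℝ (Fin n)) := rfl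
    rw [h2, ← Measure.map_map (measurable_const_add μ)
      (LinearMap.continuous_of_finiteDimensional _).measurable, h1, Measure.map_smul,
      map_add_left_eq_self]
  -- Since `g x - μ = A x` and `S = A²`, the quadratic form at `g x` is `‖x‖²`. The factor `|det A|`
  -- comes from `√det S` and cancels against the Jacobian in `hmap`.
  have hdens : ∀ x : EuclideanSpace ℝ (Fin n),
      1 / √((2 * Real.pi) ^ n) * Real.exp (-(1 / 2) * ‖x‖ ^ 2)
        = |A.det| * gaussianDensity μ S (g x) := by
    intro x
    have hquad : (g x - μ).ofLp ⬝ᵥ (S⁻¹ *ᵥ (g x - μ).ofLp) = ‖x‖ ^ 2 := by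
      have h1 : (g x - μ).ofLp = A *ᵥ x.ofLp := by
        simp only [hg, add_sub_cancel_left]
        rfl
      have hu : IsUnit A.det := isUnit_iff_ne_zero.2 hA0
      rw [h1, ← hAA, Matrix.mul_inv_rev, Matrix.mulVec_mulVec, Matrix.mul_assoc,
        Matrix.nonsing_inv_mul _ hu, Matrix.mul_one, Matrix.dotProduct_mulVec, Matrix.vecMul_mulVec,
        hAsymm, Matrix.mul_nonsing_inv _ hu, Matrix.vecMul_one, EuclideanSpace.real_norm_sq_eq]
      simp only [dotProduct, sq]
    have hsqrt : √((2 * Real.pi) ^ n * S.det) = √((2 * Real.pi) ^ n) * |A.det| := by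
      rw [Real.sqrt_mul (by positivity), ← hdetA, Real.sqrt_mul_self_eq_abs]
    have h3 : |A.det| ≠ 0 := abs_ne_zero.2 hA0
    have h4 : √((2 * Real.pi) ^ n) ≠ 0 := by positivity
    rw [gaussianDensity, hquad, hsqrt]
    field_simp
  have hGm : Measurable fun y => ENNReal.ofReal (gaussianDensity μ S y) := by
    unfold gaussianDensity dotProduct Matrix.mulVec dotProduct
    fun_prop
  have hpos : ENNReal.ofReal |A.det| * ENNReal.ofReal |A.det⁻¹| = 1 := by
    rw [← ENNReal.ofReal_mul (abs_nonneg _), ← abs_mul, mul_inv_cancel₀ hA0, abs_one,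
      ENNReal.ofReal_one]
  rw [multivariateGaussian, stdGaussian_eq_withDensity]
  change Measure.map g _ = _
  simp_rw [hdens]
  ext B hB
  rw [Measure.map_apply hgm hB, withDensity_apply _ (hgm hB), withDensity_apply _ hB,
    ← setLIntegral_map hB (f := fun y => ENNReal.ofReal (|A.det| * gaussianDensity μ S y))
      (by simp_rw [ENNReal.ofReal_mul (abs_nonneg _)]; exact hGm.const_mul _) hgm, hmap,
    setLIntegral_smul_measure]
  simp_rw [ENNReal.ofReal_mul (abs_nonneg A.det)]
  rw [lintegral_const_mul _ hGm, smul_eq_mul, ← mul_assoc, mul_comm (ENNReal.ofReal |A.det⁻¹|),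
    hpos, one_mul]

end GaussianDensity

/-! ### Positivity of the covariance matrix. -/

section Covariance

variable {n m : ℕ} {p : Profile n} {Θ : Parameters n m} {T : ℝ} {zi0 : Fin n → ℝ} {s t : ℝ}

/-- The quadratic form of the covariance matrix. -/
theorem Profile.Solves.dotProduct_cov_mulVec (hp : p.Solves Θ T zi0) (hs : 0 ≤ s) (hst : s ≤ t)
    (ht : t ≤ T) (ξ : Fin n → ℝ) :
    ξ ⬝ᵥ (p.cov Θ s t *ᵥ ξ) = ∫ u in s..t,
      (ξ ᵥ* (p.Φx t * (p.Φx u)⁻¹) ᵥ* Θ.D) ⬝ᵥ (ξ ᵥ* (p.Φx t * (p.Φx u)⁻¹) ᵥ* Θ.D) := by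
  have hΦ := hp.continuousOn_Φx_inv.mono (Set.Icc_subset_Icc hs ht)
  have hΦT : ContinuousOn (fun u => ((p.Φx u)⁻¹)ᵀ) (Set.Icc s t) :=
    continuousOn_pi.2 fun i => continuousOn_pi.2 fun j => hΦ.matrix_elem j i
  have hc := ((hΦ.matrix_mul (continuousOn_const (c := Θ.D))).matrix_mul
    (continuousOn_const (c := Θ.Dᵀ))).matrix_mul hΦT
  rw [Profile.cov, ← Matrix.mulVec_mulVec, ← Matrix.mulVec_mulVec, Matrix.dotProduct_mulVec,
    matrixIntegral_mulVec hst hc,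
    dotProduct_vectorIntegral hst (hc.matrix_mulVec continuousOn_const)]
  refine intervalIntegral.integral_congr fun u _ => ?_
  simp only [Matrix.mulVec_transpose, ← Matrix.mulVec_mulVec, Matrix.dotProduct_mulVec,
    ← Matrix.vecMul_vecMul]

theorem Profile.cov_transpose (p : Profile n) (Θ : Parameters n m) (s t : ℝ) :
    (p.cov Θ s t)ᵀ = p.cov Θ s t := by
  have h : (matrixIntegral s t fun u => (p.Φx u)⁻¹ * Θ.D * Θ.Dᵀ * ((p.Φx u)⁻¹)ᵀ)ᵀ
      = matrixIntegral s t fun u => (p.Φx u)⁻¹ * Θ.D * Θ.Dᵀ * ((p.Φx u)⁻¹)ᵀ := by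
    ext i j
    refine intervalIntegral.integral_congr fun u _ => ?_
    change ((p.Φx u)⁻¹ * Θ.D * Θ.Dᵀ * ((p.Φx u)⁻¹)ᵀ)ᵀ i j = _
    simp only [Matrix.transpose_mul, Matrix.transpose_transpose, Matrix.mul_assoc]
  rw [Profile.cov, Matrix.transpose_mul, Matrix.transpose_mul, Matrix.transpose_transpose, h,
    Matrix.mul_assoc]

theorem Profile.Solves.posSemidef_cov (hp : p.Solves Θ T zi0) (hs : 0 ≤ s) (hst : s ≤ t)
    (ht : t ≤ T) : (p.cov Θ s t).PosSemidef := by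
  refine Matrix.PosSemidef.of_dotProduct_mulVec_nonneg ?_ fun ξ => ?_
  · rw [Matrix.IsHermitian, Matrix.conjTranspose_eq_transpose_of_trivial]
    exact p.cov_transpose Θ s t
  · rw [star_trivial, hp.dotProduct_cov_mulVec hs hst ht]
    exact intervalIntegral.integral_nonneg hst fun u _ =>
      Finset.sum_nonneg fun i _ => mul_self_nonneg _

/-- A nonzero null vector `ξ` would make the integral of `|ξᵀ Φx(t) Φx(u)⁻¹ D|²` vanish. The matrix
in it is invertible, so the integrand is positive, and the interval has positive length. -/
theorem Profile.Solves.det_cov_ne_zero (hp : p.Solves Θ T zi0) (hs : 0 ≤ s) (hst : s < t)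
    (ht : t ≤ T) (hD : Θ.D.det ≠ 0) : (p.cov Θ s t).det ≠ 0 := by
  intro h0
  obtain ⟨ξ, hξ, hcov⟩ := Matrix.exists_mulVec_eq_zero_iff.2 h0
  have hsub : Set.Icc s t ⊆ Set.Icc 0 T := Set.Icc_subset_Icc hs ht
  have hint := hp.dotProduct_cov_mulVec hs hst.le ht ξ
  rw [hcov, dotProduct_zero] at hint
  have hk : ContinuousOn (fun u => ξ ᵥ* (p.Φx t * (p.Φx u)⁻¹) ᵥ* Θ.D) (Set.Icc s t) :=
    (continuousOn_const.vecMul (continuousOn_const.matrix_mul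
      (hp.continuousOn_Φx_inv.mono hsub))).vecMul continuousOn_const
  have hpos : 0 < ∫ u in s..t,
      (ξ ᵥ* (p.Φx t * (p.Φx u)⁻¹) ᵥ* Θ.D) ⬝ᵥ (ξ ᵥ* (p.Φx t * (p.Φx u)⁻¹) ᵥ* Θ.D) := by
    refine intervalIntegral.intervalIntegral_pos_of_pos_on
      ((hk.dotProduct hk).intervalIntegrable_of_Icc hst.le) (fun u hu => ?_) hst
    have hunit : IsUnit (p.Φx t * (p.Φx u)⁻¹ * Θ.D) := by
      refine ((hp.isUnit_Φx (hsub (Set.right_mem_Icc.2 hst.le))).mul ?_).mul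
        ((Matrix.isUnit_iff_isUnit_det _).2 hD.isUnit)
      exact (Matrix.isUnit_nonsing_inv_iff).2 (hp.isUnit_Φx (hsub (Set.Ioo_subset_Icc_self hu)))
    refine lt_of_le_of_ne (Finset.sum_nonneg fun i _ => mul_self_nonneg _) fun hz => hξ ?_
    have hz' := dotProduct_self_eq_zero.1 hz.symm
    rw [Matrix.vecMul_vecMul] at hz'
    exact Matrix.vecMul_injective_iff_isUnit.2 hunit (hz'.trans (Matrix.zero_vecMul _).symm)
  exact hpos.ne hint

end Covariance

/-! ### The deviation of the trajectory from its mean. -/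

section Noise

open Filter Topology

variable {n m : ℕ} {p : Profile n} {Θ : Parameters n m} {T : ℝ≥0} {zi0 Ebar Ei : Fin n → ℝ}
  {Ω : Type*} {mΩ : MeasurableSpace Ω} {P : Measure Ω} {𝓕 : Filtration ℝ≥0 mΩ}
  {W X : ℝ≥0 → Ω → EuclideanSpace ℝ (Fin n)} {r s t : ℝ≥0}

theorem continuousOn_comp_toNNReal {x : ℝ≥0 → EuclideanSpace ℝ (Fin n)}
    (hx : ContinuousOn x (Set.Icc s t)) :
    ContinuousOn (fun u : ℝ => (x u.toNNReal).ofLp) (Set.Icc (s : ℝ) t) := by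
  refine (PiLp.continuous_ofLp 2 _).comp_continuousOn
    (hx.comp continuous_real_toNNReal.continuousOn fun u hu => ?_)
  exact ⟨NNReal.le_toNNReal_of_coe_le hu.1, Real.toNNReal_le_iff_le_coe.2 hu.2⟩

theorem Profile.Solves.continuousOn_drift (hp : p.Solves Θ T zi0) {x : ℝ → Fin n → ℝ}
    (hx : ContinuousOn x (Set.Icc (s : ℝ) t)) (ht : t ≤ T) :
    ContinuousOn (fun u => p.drift Θ T Ebar Ei u (x u)) (Set.Icc (s : ℝ) t) := by
  have hsub : Set.Icc (s : ℝ) t ⊆ Set.Icc 0 (T : ℝ) :=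
    Set.Icc_subset_Icc s.coe_nonneg (NNReal.coe_le_coe.2 ht)
  simp only [Profile.drift_eq]
  exact ((hp.continuousOn_closedLoop.mono hsub).matrix_mulVec hx).add
    ((hp.continuousOn_inhomogeneity.mono hsub).add
      ((hp.continuousOn_K.mono hsub).matrix_mulVec continuousOn_const))

/-- A private trajectory may be restarted at any later time. -/
theorem IsPrivateTrajectory.restart (hp : p.Solves Θ T zi0)
    (hX : IsPrivateTrajectory P 𝓕 W Θ T p Ebar Ei r X) (hrs : r ≤ s) (hsT : s ≤ T) :
    IsPrivateTrajectory P 𝓕 W Θ T p Ebar Ei s X where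
  adapted t ht := hX.adapted t (Set.Icc_subset_Icc_left hrs ht)
  continuous := hX.continuous.mono fun ω hω => hω.mono (Set.Icc_subset_Icc_left hrs)
  sde := by
    filter_upwards [hX.continuous, hX.sde] with ω hc hω t ht
    have h1 := hω t (Set.Icc_subset_Icc_left hrs ht)
    have h2 := hω s ⟨hrs, hsT⟩
    have hdrift := continuousOn_pi.1 (hp.continuousOn_drift (Ebar := Ebar) (Ei := Ei)
      (continuousOn_comp_toNNReal hc) le_rfl)
    have hsplit : vectorIntegral r t (fun u => p.drift Θ T Ebar Ei u (X u.toNNReal ω).ofLp)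
        = vectorIntegral r s (fun u => p.drift Θ T Ebar Ei u (X u.toNNReal ω).ofLp)
          + vectorIntegral s t (fun u => p.drift Θ T Ebar Ei u (X u.toNNReal ω).ofLp) := by
      funext i
      refine (intervalIntegral.integral_add_adjacent_intervals ?_ ?_).symm
      · exact ((hdrift i).mono (Set.Icc_subset_Icc_right
          (NNReal.coe_le_coe.2 hsT))).intervalIntegrable_of_Icc (NNReal.coe_le_coe.2 hrs)
      · exact ((hdrift i).mono (Set.Icc_subset_Icc (NNReal.coe_le_coe.2 hrs)
          (NNReal.coe_le_coe.2 ht.2))).intervalIntegrable_of_Icc (NNReal.coe_le_coe.2 ht.1)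
    have hW : Θ.D *ᵥ (W t ω - W r ω).ofLp
        = Θ.D *ᵥ (W s ω - W r ω).ofLp + Θ.D *ᵥ (W t ω - W s ω).ofLp := by
      rw [← Matrix.mulVec_add, ← WithLp.ofLp_add, sub_add_sub_cancel']
    rw [h1, h2, hsplit, hW]
    abel

theorem IsWienerProcess.ae_continuous (hW : IsWienerProcess P 𝓕 W) :
    ∀ᵐ ω ∂P, Continuous fun t => W t ω := by
  have h : ∀ᵐ ω ∂P, ∀ i, Continuous fun t => W t ω i := ae_all_iff.2 fun i => (hW.brownian i).cont
  filter_upwards [h] with ω hω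
  exact (PiLp.continuous_toLp 2 fun _ : Fin n => ℝ).comp (continuous_pi hω)

/-- The deviation of a private trajectory from its conditional mean is a limit of Riemann–Stieltjes
sums against the driving Wiener process. -/
theorem IsPrivateTrajectory.ae_tendsto_noise (hp : p.Solves Θ T zi0) (hW : IsWienerProcess P 𝓕 W)
    (hX : IsPrivateTrajectory P 𝓕 W Θ T p Ebar Ei s X) (hst : s ≤ t) (htT : t ≤ T)
    (ξ : Fin n → ℝ) :
    ∀ᵐ ω ∂P, Tendsto (fun k => ∑ j ∈ Finset.range (k + 1),
      (ξ ᵥ* (p.Φx t * (p.Φx (uniformPartition s t k j))⁻¹) ᵥ* Θ.D) ⬝ᵥ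
        (W (uniformPartition s t k (j + 1)).toNNReal ω
          - W (uniformPartition s t k j).toNNReal ω).ofLp) atTop
      (𝓝 (ξ ⬝ᵥ (X t ω - p.mean Θ T Ebar Ei s t (X s ω)).ofLp)) := by
  filter_upwards [hX.continuous, hX.sde, hW.ae_continuous] with ω hXc hXω hWc
  have hst' : (s : ℝ) ≤ t := NNReal.coe_le_coe.2 hst
  have hsub : Set.Icc (s : ℝ) t ⊆ Set.Icc 0 (T : ℝ) :=
    Set.Icc_subset_Icc s.coe_nonneg (NNReal.coe_le_coe.2 htT)
  have htI : (t : ℝ) ∈ Set.Icc 0 (T : ℝ) := hsub (Set.right_mem_Icc.2 hst')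
  have hb : ContinuousOn
      (fun u => p.inhomogeneity Θ u + p.K Θ T u *ᵥ stackedError Ebar Ei) (Set.Icc (s : ℝ) t) :=
    (hp.continuousOn_inhomogeneity.mono hsub).add
      ((hp.continuousOn_K.mono hsub).matrix_mulVec continuousOn_const)
  have hinv := hp.Φx_ode.inv fun _ => hp.isUnit_Φx
  -- The test function `ξᵀ Φx(t) Φx(v)⁻¹` solves the adjoint equation and equals `ξ` at `v = t`.
  have hh : ∀ v ∈ Set.Icc (s : ℝ) t, ∀ i,
      HasDerivWithinAt (fun v => (ξ ᵥ* (p.Φx t * (p.Φx v)⁻¹)) i)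
        ((-((ξ ᵥ* (p.Φx t * (p.Φx v)⁻¹)) ᵥ* p.closedLoop Θ v)) i) (Set.Icc (s : ℝ) t) v := by
    intro v hv i
    have h1 : HasDerivWithinAt (fun v => ((ξ ᵥ* p.Φx t) ᵥ* (p.Φx v)⁻¹) i)
        (((ξ ᵥ* p.Φx t) ᵥ* (-((p.Φx v)⁻¹ * p.closedLoop Θ v))) i) (Set.Icc (s : ℝ) t) v := by
      simp only [Matrix.vecMul, dotProduct]
      exact HasDerivWithinAt.fun_sum fun l _ =>
        ((hinv v (hsub hv) l i).mono hsub).const_mul _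
    simpa only [Matrix.vecMul_neg, Matrix.vecMul_vecMul, Matrix.mul_assoc] using h1
  have key := tendsto_sum_vecMul_dotProduct_increment (D := Θ.D)
    (x := fun u => (X u.toNNReal ω).ofLp) (w := fun u => (W u.toNNReal ω - W s ω).ofLp) hst'
    (hp.continuousOn_closedLoop.mono hsub) hb
    (continuousOn_comp_toNNReal (hXc.mono (Set.Icc_subset_Icc_right htT)))
    (continuousOn_comp_toNNReal (x := fun u => W u ω - W s ω)
      (hWc.sub continuous_const).continuousOn)
    (by simp) (fun u hu => ?_) hh
  · have hlim : ξ ⬝ᵥ (X t ω - p.mean Θ T Ebar Ei s t (X s ω)).ofLp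
        = (ξ ᵥ* (p.Φx t * (p.Φx t)⁻¹)) ⬝ᵥ (X (t : ℝ).toNNReal ω).ofLp
          - (ξ ᵥ* (p.Φx t * (p.Φx s)⁻¹)) ⬝ᵥ (X (s : ℝ).toNNReal ω).ofLp
          - ∫ v in (s : ℝ)..t, (ξ ᵥ* (p.Φx t * (p.Φx v)⁻¹)) ⬝ᵥ
            (p.inhomogeneity Θ v + p.K Θ T v *ᵥ stackedError Ebar Ei) := by
      rw [WithLp.ofLp_sub, hp.mean_eq Ebar Ei s.coe_nonneg hst' (NNReal.coe_le_coe.2 htT),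
        dotProduct_sub, dotProduct_add, Real.toNNReal_coe, Real.toNNReal_coe,
        Matrix.mul_nonsing_inv _ ((Matrix.isUnit_iff_isUnit_det _).1 (hp.isUnit_Φx htI)),
        Matrix.vecMul_one, Matrix.dotProduct_mulVec, Matrix.dotProduct_mulVec ξ (p.Φx t),
        dotProduct_vectorIntegral hst' ((hp.continuousOn_Φx_inv.mono hsub).matrix_mulVec hb)]
      simp only [Matrix.dotProduct_mulVec, Matrix.vecMul_vecMul]
      ring
    rw [hlim]
    refine key.congr fun k => Finset.sum_congr rfl fun j _ => ?_
    rw [← WithLp.ofLp_sub, sub_sub_sub_cancel_right]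
  · have huI : u.toNNReal ∈ Set.Icc s T := ⟨NNReal.le_toNNReal_of_coe_le hu.1,
      (Real.toNNReal_le_iff_le_coe.2 hu.2).trans htT⟩
    have h1 := hXω _ huI
    simp only [Profile.drift_eq] at h1
    rw [Real.coe_toNNReal u (s.coe_nonneg.trans hu.1)] at h1
    simp only [Real.toNNReal_coe]
    exact h1

open Complex in
-- The left side is the limit of the same integrals for the Riemann–Stieltjes sums. Those are
-- explicit, with exponents that are Riemann sums of the quadratic form of the covariance. Keeping a
-- general event `A` of the past is what later yields independence.
theorem IsPrivateTrajectory.setIntegral_cexp_noise [IsProbabilityMeasure P] (hp : p.Solves Θ T zi0)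
    (hW : IsWienerProcess P 𝓕 W) (hX : IsPrivateTrajectory P 𝓕 W Θ T p Ebar Ei s X) (hst : s ≤ t)
    (htT : t ≤ T) {A : Set Ω}
    (hA : MeasurableSet[𝓕 s] A) (ξ : Fin n → ℝ) :
    ∫ ω in A, cexp ((ξ ⬝ᵥ (X t ω - p.mean Θ T Ebar Ei s t (X s ω)).ofLp : ℝ) * I) ∂P
      = P.real A * cexp (-(1 / 2) * (ξ ⬝ᵥ (p.cov Θ s t *ᵥ ξ) : ℝ)) := by
  have hst' : (s : ℝ) ≤ t := NNReal.coe_le_coe.2 hst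
  have hsub : Set.Icc (s : ℝ) t ⊆ Set.Icc 0 (T : ℝ) :=
    Set.Icc_subset_Icc s.coe_nonneg (NNReal.coe_le_coe.2 htT)
  set k : ℝ → Fin n → ℝ := fun v => ξ ᵥ* (p.Φx t * (p.Φx v)⁻¹) ᵥ* Θ.D with hk
  have hkc : ContinuousOn k (Set.Icc (s : ℝ) t) :=
    (continuousOn_const.vecMul (continuousOn_const.matrix_mul
      (hp.continuousOn_Φx_inv.mono hsub))).vecMul continuousOn_const
  set Z : ℕ → Ω → ℝ := fun K ω => ∑ j ∈ Finset.range (K + 1), k (uniformPartition s t K j) ⬝ᵥ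
    (W (uniformPartition s t K (j + 1)).toNNReal ω
      - W (uniformPartition s t K j).toNNReal ω).ofLp with hZ
  have hWm : ∀ u, Measurable (W u) := fun u => (hW.adapted u).mono (𝓕.le u) le_rfl
  have hdot : ∀ v : Fin n → ℝ, Measurable fun x : EuclideanSpace ℝ (Fin n) => v ⬝ᵥ x.ofLp := by
    intro v
    unfold dotProduct
    fun_prop
  have hexp : Measurable fun x : ℝ => cexp (x * I) := by fun_prop
  have hZm : ∀ K, Measurable (Z K) := fun K =>
    Finset.measurable_fun_sum _ fun j _ => (hdot _).comp ((hWm _).sub (hWm _))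
  have hlim1 : Tendsto (fun K => ∫ ω in A, cexp ((Z K ω : ℝ) * I) ∂P) atTop
      (𝓝 (∫ ω in A, cexp ((ξ ⬝ᵥ (X t ω - p.mean Θ T Ebar Ei s t (X s ω)).ofLp : ℝ) * I) ∂P)) := by
    -- Exponentials of imaginary numbers have modulus `1`, so almost sure convergence of the sums
    -- suffices.
    refine tendsto_integral_of_dominated_convergence (fun _ => 1)
      (fun K => (hexp.comp (hZm K)).aestronglyMeasurable) (integrable_const _)
      (fun K => Eventually.of_forall fun ω => (Complex.norm_exp_ofReal_mul_I _).le) ?_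
    filter_upwards [ae_restrict_of_ae (hX.ae_tendsto_noise hp hW hst htT ξ)] with ω hω
    have hc : Continuous fun x : ℝ => cexp (x * I) := by fun_prop
    exact (hc.tendsto _).comp hω
  have hval : ∀ K, ∫ ω in A, cexp ((Z K ω : ℝ) * I) ∂P = P.real A * cexp (-(1 / 2) *
      (∑ j ∈ Finset.range (K + 1), (k (uniformPartition s t K j) ⬝ᵥ k (uniformPartition s t K j))
        * (uniformPartition s t K (j + 1) - uniformPartition s t K j) : ℝ)) := by
    intro K
    -- The partition points are nonnegative, so passing through `Real.toNNReal` does not change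
    -- them.
    have hnn : ∀ j, 0 ≤ uniformPartition s t K j := fun j => by
      have := uniformPartition_mono hst' K (Nat.zero_le j)
      rw [uniformPartition_zero] at this
      exact s.coe_nonneg.trans this
    have h0 : (uniformPartition s t K 0).toNNReal = s := by
      rw [uniformPartition_zero, Real.toNNReal_coe]
    have h1 := hW.setIntegral_cexp_sum_increments (P := P)
      (τ := fun j => (uniformPartition s t K j).toNNReal)
      (fun _ _ hij => Real.toNNReal_mono (uniformPartition_mono hst' K hij))
      (fun j => k (uniformPartition s t K j)) (A := A)
      (by rw [h0]; exact hA) (K + 1)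
    simp only [Real.coe_toNNReal _ (hnn _)] at h1
    exact h1
  have hlim2 := tendsto_riemann_sum (f := fun v => k v ⬝ᵥ k v) hst' (hkc.dotProduct hkc)
  rw [← hp.dotProduct_cov_mulVec s.coe_nonneg hst' (NNReal.coe_le_coe.2 htT)] at hlim2
  have hc : Continuous fun x : ℝ => (P.real A : ℂ) * cexp (-(1 / 2) * (x : ℂ)) := by fun_prop
  refine tendsto_nhds_unique hlim1 ?_
  simp_rw [hval]
  exact (hc.tendsto _).comp hlim2

theorem Profile.measurable_mean (p : Profile n) (Θ : Parameters n m) (T : ℝ) (Ebar Ei : Fin n → ℝ)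
    (s t : ℝ) : Measurable (p.mean Θ T Ebar Ei s t) := by
  refine Continuous.measurable ((PiLp.continuous_toLp 2 _).comp (Continuous.add ?_ continuous_const))
  exact (continuous_const.matrix_mulVec (PiLp.continuous_ofLp 2 _)).add continuous_const

theorem IsPrivateTrajectory.measurable_noise
    (hX : IsPrivateTrajectory P 𝓕 W Θ T p Ebar Ei s X) (hst : s ≤ t) (htT : t ≤ T) :
    Measurable fun ω => X t ω - p.mean Θ T Ebar Ei s t (X s ω) :=
  ((hX.adapted t ⟨hst, htT⟩).mono (𝓕.le t) le_rfl).sub ((p.measurable_mean Θ T Ebar Ei s t).comp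
    ((hX.adapted s ⟨le_rfl, hst.trans htT⟩).mono (𝓕.le s) le_rfl))

/-- On every event of the past, the deviation of a private trajectory from its conditional mean is
centered Gaussian with the stated covariance. -/
theorem IsPrivateTrajectory.map_restrict_noise [IsProbabilityMeasure P] (hp : p.Solves Θ T zi0)
    (hW : IsWienerProcess P 𝓕 W) (hX : IsPrivateTrajectory P 𝓕 W Θ T p Ebar Ei s X) (hst : s ≤ t)
    (htT : t ≤ T) {A : Set Ω} (hA : MeasurableSet[𝓕 s] A) :
    (P.restrict A).map (fun ω => X t ω - p.mean Θ T Ebar Ei s t (X s ω))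
      = P A • multivariateGaussian 0 (p.cov Θ s t) := by
  have hN := hX.measurable_noise hst htT
  have : IsFiniteMeasure (P A • multivariateGaussian 0 (p.cov Θ s t)) :=
    Measure.smul_finite _ (measure_ne_top P A)
  refine Measure.ext_of_charFun (funext fun ξ => ?_)
  have hS := hp.posSemidef_cov s.coe_nonneg (NNReal.coe_le_coe.2 hst) (NNReal.coe_le_coe.2 htT)
  rw [charFun_apply, charFun_apply, integral_map hN.aemeasurable
    (Measurable.aestronglyMeasurable (by fun_prop)), integral_smul_measure, ← charFun_apply,
    charFun_multivariateGaussian hS]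
  have hinner : ∀ x : EuclideanSpace ℝ (Fin n), inner ℝ x ξ = ξ.ofLp ⬝ᵥ x.ofLp := by
    intro x
    rw [EuclideanSpace.inner_eq_star_dotProduct, star_trivial]
  simp_rw [hinner]
  rw [hX.setIntegral_cexp_noise hp hW hst htT hA, Complex.real_smul]
  congr 2
  simp
  ring

end Noise

/-! ### From the law of the deviation to the transition law. -/

section TransitionLaw

variable {n m : ℕ} {p : Profile n} {Θ : Parameters n m} {T : ℝ≥0} {zi0 Ebar Ei : Fin n → ℝ}
  {Ω : Type*} {mΩ : MeasurableSpace Ω} {P : Measure Ω} [IsProbabilityMeasure P]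
  {𝓕 : Filtration ℝ≥0 mΩ} {W X : ℝ≥0 → Ω → EuclideanSpace ℝ (Fin n)} {s t : ℝ≥0}

theorem map_const_add_multivariateGaussian (μ : EuclideanSpace ℝ (Fin n))
    (S : Matrix (Fin n) (Fin n) ℝ) :
    (multivariateGaussian 0 S).map (fun y => μ + y) = multivariateGaussian μ S := by
  rw [multivariateGaussian, Measure.map_map (by fun_prop) (by fun_prop), multivariateGaussian]
  congr 1
  funext x
  simp

theorem Profile.Solves.isLawFromPoints (hp : p.Solves Θ T zi0) (hW : IsWienerProcess P 𝓕 W)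
    (hst : s ≤ t) (htT : t ≤ T) :
    IsLawFromPoints P 𝓕 W Θ T p Ebar Ei s t
      (fun x => multivariateGaussian (p.mean Θ T Ebar Ei s t x) (p.cov Θ s t)) := by
  intro x X hX hx
  have hnoise := hX.map_restrict_noise hp hW hst htT MeasurableSet.univ
  rw [Measure.restrict_univ, measure_univ, one_smul] at hnoise
  have hae : X t =ᵐ[P] fun ω => p.mean Θ T Ebar Ei s t x
      + (X t ω - p.mean Θ T Ebar Ei s t (X s ω)) := by
    filter_upwards [hx] with ω hω
    rw [hω, add_sub_cancel]
  beta_reduce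
  rw [Measure.map_congr hae, ← map_const_add_multivariateGaussian, ← hnoise,
    Measure.map_map (by fun_prop) (hX.measurable_noise hst htT)]
  rfl

/-- `X t` is the `𝓕 s`-measurable mean plus a deviation independent of `𝓕 s`, so conditioning
freezes the mean and integrates out the deviation. -/
theorem IsPrivateTrajectory.isTransitionLaw (hp : p.Solves Θ T zi0) (hW : IsWienerProcess P 𝓕 W)
    (hX : IsPrivateTrajectory P 𝓕 W Θ T p Ebar Ei s X) (hst : s ≤ t) (htT : t ≤ T) :
    IsTransitionLaw P 𝓕 X s t
      (fun x => multivariateGaussian (p.mean Θ T Ebar Ei s t x) (p.cov Θ s t)) := by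
  intro S hS
  set γ := multivariateGaussian (0 : EuclideanSpace ℝ (Fin n)) (p.cov Θ s t)
  set f := p.mean Θ T Ebar Ei s t
  have hf : Measurable f := p.measurable_mean Θ T Ebar Ei s t
  have hN := hX.measurable_noise hst htT
  have hXs : Measurable[𝓕 s] (X s) := hX.adapted s ⟨le_rfl, hst.trans htT⟩
  have hXs' : Measurable (X s) := hXs.mono (𝓕.le s) le_rfl
  have hXt : Measurable (X t) := (hX.adapted t ⟨hst, htT⟩).mono (𝓕.le t) le_rfl
  set E : Set (EuclideanSpace ℝ (Fin n) × EuclideanSpace ℝ (Fin n)) := {q | f q.1 + q.2 ∈ S}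
  have hE : MeasurableSet E := ((hf.comp measurable_fst).add measurable_snd) hS
  -- Writing the kernel as the `γ`-measure of a section of `E` gives its measurability in `x` and
  -- prepares for Fubini.
  have hκ : ∀ x, multivariateGaussian (f x) (p.cov Θ s t) S = γ (Prod.mk x ⁻¹' E) := by
    intro x
    rw [← map_const_add_multivariateGaussian, Measure.map_apply (by fun_prop) hS]
    rfl
  have hκm : Measurable fun x => γ (Prod.mk x ⁻¹' E) := measurable_measure_prodMk_left hE
  have hset : ∀ A, MeasurableSet[𝓕 s] A →
      ∫⁻ ω in A, γ (Prod.mk (X s ω) ⁻¹' E) ∂P = P (A ∩ X t ⁻¹' S) := by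
    intro A hA
    -- The joint law of `X s` and the deviation on `A` is a product. On rectangles this is the law
    -- of the deviation on the smaller past event `A ∩ X s ⁻¹' B`.
    have hprod : ((P.restrict A).map (X s)).prod γ
        = (P.restrict A).map fun ω => (X s ω, X t ω - f (X s ω)) := by
      refine Measure.prod_eq fun B C hB hC => ?_
      have hAB : MeasurableSet[𝓕 s] (A ∩ X s ⁻¹' B) := hA.inter (hXs hB)
      have h1 := congrArg (fun ν => ν C) (hX.map_restrict_noise hp hW hst htT hAB)
      simp only [Measure.smul_apply, smul_eq_mul] at h1
      rw [Measure.map_apply hN hC, Measure.restrict_apply (hN hC)] at h1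
      rw [Measure.map_apply (hXs'.prodMk hN) (hB.prod hC),
        Measure.restrict_apply ((hXs'.prodMk hN) (hB.prod hC)), Measure.map_apply hXs' hB,
        Measure.restrict_apply (hXs' hB), Set.inter_comm (X s ⁻¹' B), ← h1]
      congr 1
      ext ω
      simp only [Set.mem_inter_iff, Set.mem_preimage, Set.mem_prod]
      tauto
    rw [← lintegral_map hκm hXs', ← Measure.prod_apply hE, hprod,
      Measure.map_apply (hXs'.prodMk hN) hE, Measure.restrict_apply ((hXs'.prodMk hN) hE),
      Set.inter_comm]
    congr 2
    ext ω
    change f (X s ω) + (X t ω - f (X s ω)) ∈ S ↔ X t ω ∈ S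
    rw [add_sub_cancel]
  have hreal : ∀ ω, (multivariateGaussian (f (X s ω)) (p.cov Θ s t)).real S
      = (γ (Prod.mk (X s ω) ⁻¹' E)).toReal := fun ω => by rw [Measure.real, hκ]
  have hmeas : Measurable[𝓕 s] fun ω => (γ (Prod.mk (X s ω) ⁻¹' E)).toReal :=
    hκm.ennreal_toReal.comp hXs
  simp_rw [hreal]
  -- The candidate is `𝓕 s`-measurable, bounded by `1`, and by `hset` has the right integral over
  -- every event of the past.
  refine (ae_eq_condExp_of_forall_setIntegral_eq (𝓕.le s)
    ((integrable_const (1 : ℝ)).indicator (hXt hS)) (fun A _ _ => ?_) (fun A hA _ => ?_)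
    hmeas.stronglyMeasurable.aestronglyMeasurable).symm
  · refine (Integrable.of_bound (C := 1) (hmeas.mono (𝓕.le s) le_rfl).aestronglyMeasurable
      (Filter.Eventually.of_forall fun ω => ?_)).integrableOn
    rw [Real.norm_of_nonneg ENNReal.toReal_nonneg]
    exact measureReal_le_one
  · rw [integral_toReal (f := fun ω => γ (Prod.mk (X s ω) ⁻¹' E)) (hκm.comp hXs').aemeasurable
      (Filter.Eventually.of_forall fun ω => measure_lt_top γ _), hset A hA,
      setIntegral_indicator (hXt hS), setIntegral_const, smul_eq_mul, mul_one]
    rfl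

end TransitionLaw

end ErroneousMFG

/-! ### The transition density of the private trajectory. -/

theorem theorem3p1 {n m : ℕ} (Θ : Parameters n m) (hR : Θ.R.PosDef) (T : ℝ≥0) (hT : 0 < T)
    (z0 Ebar Ei : Fin n → ℝ) (p : Profile n) (hp : p.Solves Θ T (z0 + Ei))
    {Ω : Type*} [mΩ : MeasurableSpace Ω] (P : Measure Ω) [IsProbabilityMeasure P]
    (𝓕 : Filtration ℝ≥0 mΩ) (W : ℝ≥0 → Ω → EuclideanSpace ℝ (Fin n))
    (hW : IsWienerProcess P 𝓕 W)
    (xi : ℝ≥0 → Ω → EuclideanSpace ℝ (Fin n))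
    (hxi : IsPrivateTrajectory P 𝓕 W Θ T p Ebar Ei 0 xi)
    (s t : ℝ≥0) (hst : s < t) (htT : t ≤ T) :
    -- the covariance matrix is positive semidefinite, and it is nonsingular if `D` is
    (p.cov Θ s t).PosSemidef ∧ (Θ.D.det ≠ 0 → (p.cov Θ s t).det ≠ 0) ∧
    -- the transition law is normal with the stated mean and covariance
    IsLawFromPoints P 𝓕 W Θ T p Ebar Ei s t
      (fun x => multivariateGaussian (p.mean Θ T Ebar Ei s t x) (p.cov Θ s t)) ∧
    IsTransitionLaw P 𝓕 xi s t
      (fun x => multivariateGaussian (p.mean Θ T Ebar Ei s t x) (p.cov Θ s t)) ∧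
    -- it has the stated density as soon as the covariance matrix is nonsingular
    ((p.cov Θ s t).det ≠ 0 →
      IsLawFromPoints P 𝓕 W Θ T p Ebar Ei s t
        (fun x => volume.withDensity
          fun y => ENNReal.ofReal (p.transitionDensity Θ T Ebar Ei s t x y)) ∧
      IsTransitionLaw P 𝓕 xi s t
        (fun x => volume.withDensity
          fun y => ENNReal.ofReal (p.transitionDensity Θ T Ebar Ei s t x y))) := by
  have hst' : (s : ℝ) < t := NNReal.coe_lt_coe.2 hst
  have htT' : (t : ℝ) ≤ T := NNReal.coe_le_coe.2 htT
  have hS := hp.posSemidef_cov s.coe_nonneg hst'.le htT'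
  have hlaw := hp.isLawFromPoints (Ebar := Ebar) (Ei := Ei) hW hst.le htT
  -- The given trajectory starts at time `0`, so it is first viewed as a solution on `[s,T]` with
  -- random initial value `xi s`.
  have htrans := (hxi.restart hp zero_le (hst.le.trans htT)).isTransitionLaw hp hW hst.le htT
  refine ⟨hS, hp.det_cov_ne_zero s.coe_nonneg hst' htT', hlaw, htrans, fun hdet => ?_⟩
  have hκ : (fun x => multivariateGaussian (p.mean Θ T Ebar Ei s t x) (p.cov Θ s t))
      = fun x => volume.withDensity
        fun y => ENNReal.ofReal (p.transitionDensity Θ T Ebar Ei s t x y) :=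
    funext fun x => multivariateGaussian_eq_withDensity _ hS hdet
  rw [hκ] at hlaw htrans
  exact ⟨hlaw, htrans⟩
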